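/- Max-min allocation with a constant number of agents. An instance consists of $n$ agents, a set $\mathcal M$ of $m$ indivisible items, and for each agent $i$ a valuation $v_i : 2^{\mathcal M}\to\mathbb R_{\ge 0}$ with $v_i(\emptyset)=0$ that is monotone ($v_i(A)\le v_i(B)$ for $A\subseteq B$) and submodular ($v_i(A\cup\{g\})-v_i(A)\ge v_i(B\cup\{g\})-v_i(B)$ for $A\subseteq B$ and $g\notin B$). Let $$\mathrm{OPT}=\max_{(A_1,\dots,A_n)}\ \min_{i} v_i(A_i),$$ the maximum being over all partitions of $\mathcal M$ into $n$ labelled (possibly empty) bundles. For every fixed number of agents $n\ge 1$ and every fixed $\varepsilon>0$ there is a randomized polynomial-time algorithm with value-oracle access to $v_1,\dots,v_n$ that is a $(1-1/e-\varepsilon)$-approximation. That is, there are a program and constants $C,d\in\mathbb N$, all depending only on $n$ and $\varepsilon$, such that on every instance with $m$ items the program always halts within $C(m+1)^d$ steps with an allocation $(A_1,\dots,A_n)$ as output, and with probability at least $1-\frac{1}{m+1}$ this allocation satisfies $$\min_i v_i(A_i)\ \ge\ \Bigl(1-\frac1e-\varepsilon\Bigr)\,\mathrm{OPT}.$$ A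 step is a value query (the value $v_i(S)$ for an agent $i$ and a set $S$ written in memory), the drawing of a uniformly random element of $\{0,\dots,k\}$ for a computed $k$, a memory assignment, or a test, on a random access machine with additions, subtractions and comparisons of natural numbers, and with field operations and comparisons of real numbers (without rounding of reals to integers). -/

import Mathlib

namespace MaxMin

/-! ## Valuations, allocations and the max-min objective -/

/-- A valuation on the subsets of a finite item set `M`: nonnegative, normalized, monotone and
submodular (diminishing marginal values). -/
structure IsValuation {M : Type*} [DecidableEq M] (f : Finset M → ℝ) : Prop where
  nonneg : ∀ S, 0 ≤ f S
  empty : f ∅ = 0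
  mono : ∀ A B, A ⊆ B → f A ≤ f B
  submodular : ∀ A B, A ⊆ B → ∀ g, g ∉ B → f (insert g B) - f B ≤ f (insert g A) - f A

/-- An allocation is a map `A : Fin m → Fin n` that sends every item to the agent receiving it, so
that the bundles partition the items. This is the bundle of agent `i`. -/
def bundle {n m : ℕ} (A : Fin m → Fin n) (i : Fin n) : Finset (Fin m) :=
  Finset.univ.filter fun j => A j = i

/-- The max-min objective of an allocation: the smallest value of an agent for her bundle. -/
noncomputable def minValue {n m : ℕ} (v : Fin n → Finset (Fin m) → ℝ) (A : Fin m → Fin n) : ℝ :=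
  ⨅ i, v i (bundle A i)

/-- The optimal max-min value over all allocations. -/
noncomputable def opt {n m : ℕ} (v : Fin n → Finset (Fin m) → ℝ) : ℝ :=
  ⨆ A : Fin m → Fin n, minValue v A

/-! ## Randomized algorithms with value oracles

A real random access machine, programmed in a structured language. The memory consists of arrays of
natural numbers and arrays of real numbers. A program names its arrays by fixed numbers, while
the positions inside an array are computed. Natural numbers can be added and subtracted, real
numbers can be added, subtracted, multiplied and divided, both can be compared. The only constants
are natural numbers. There is no conversion from real to natural numbers. -/

/-- Memory: `nat a i` and `real a i` are the entries at position `i` of the array named `a`. -/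
structure Mem where
  nat : ℕ → ℕ → ℕ
  real : ℕ → ℕ → ℝ

/-- Write a natural number. -/
def Mem.setNat (μ : Mem) (a i x : ℕ) : Mem :=
  { μ with nat := Function.update μ.nat a (Function.update (μ.nat a) i x) }

/-- Write a real number. -/
def Mem.setReal (μ : Mem) (a i : ℕ) (x : ℝ) : Mem :=
  { μ with real := Function.update μ.real a (Function.update (μ.real a) i x) }

/-- Expressions for natural numbers. -/
inductive NExpr : Type
  | const (k : ℕ)
  | read (a : ℕ) (i : NExpr)
  | add (e₁ e₂ : NExpr)
  | sub (e₁ e₂ : NExpr)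

/-- Value of an expression; the subtraction is truncated at `0`. -/
def NExpr.eval (μ : Mem) : NExpr → ℕ
  | const k => k
  | read a i => μ.nat a (i.eval μ)
  | add e₁ e₂ => e₁.eval μ + e₂.eval μ
  | sub e₁ e₂ => e₁.eval μ - e₂.eval μ

/-- Expressions for real numbers; `cast` turns a natural number into a real number. -/
inductive RExpr : Type
  | cast (e : NExpr)
  | read (a : ℕ) (i : NExpr)
  | add (e₁ e₂ : RExpr)
  | sub (e₁ e₂ : RExpr)
  | mul (e₁ e₂ : RExpr)
  | div (e₁ e₂ : RExpr)

/-- Value of an expression; a division by `0` returns `0`. -/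
noncomputable def RExpr.eval (μ : Mem) : RExpr → ℝ
  | cast e => (e.eval μ : ℝ)
  | read a i => μ.real a (i.eval μ)
  | add e₁ e₂ => e₁.eval μ + e₂.eval μ
  | sub e₁ e₂ => e₁.eval μ - e₂.eval μ
  | mul e₁ e₂ => e₁.eval μ * e₂.eval μ
  | div e₁ e₂ => e₁.eval μ / e₂.eval μ

/-- Tests. -/
inductive Test : Type
  | natLe (e₁ e₂ : NExpr)
  | realLe (e₁ e₂ : RExpr)
  | neg (b : Test)
  | conj (b₁ b₂ : Test)

/-- Truth of a test. -/
def Test.Holds (μ : Mem) : Test → Prop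
  | natLe e₁ e₂ => e₁.eval μ ≤ e₂.eval μ
  | realLe e₁ e₂ => e₁.eval μ ≤ e₂.eval μ
  | neg b => ¬ b.Holds μ
  | conj b₁ b₂ => b₁.Holds μ ∧ b₂.Holds μ

/-- Programs.
* `setNat a i e`, `setReal a i e`: write the value of `e` at position `i` of array `a`.
* `query a i g s`: ask the oracle for the value that agent `g` has for the set whose indicator is
  stored in the natural-number array `s`, and write it at position `i` of the real array `a`.
* `rand a i e`: write at position `i` of the natural-number array `a` a fresh uniformly random
  element of `{0, …, e}`.
* `ite b c₁ c₂`: conditional; `loop b c`: repeat `c` while `b` holds. -/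
inductive Prog : Type
  | skip
  | setNat (a : ℕ) (i e : NExpr)
  | setReal (a : ℕ) (i : NExpr) (e : RExpr)
  | query (a : ℕ) (i g : NExpr) (s : ℕ)
  | rand (a : ℕ) (i e : NExpr)
  | seq (c₁ c₂ : Prog)
  | ite (b : Test) (c₁ c₂ : Prog)
  | loop (b : Test) (c : Prog)

/-- The answer of the value oracle; the item `j` belongs to the queried set if entry `j` of the
array `s` is nonzero. A query about an agent that does not exist returns `0`. -/
noncomputable def oracle {n m : ℕ} (v : Fin n → Finset (Fin m) → ℝ) (μ : Mem) (g s : ℕ) : ℝ :=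
  if h : g < n then v ⟨g, h⟩ (Finset.univ.filter fun j : Fin m => μ.nat s j ≠ 0) else 0

/-- A configuration: the stack of programs still to be executed, and the memory. -/
structure Config where
  stack : List Prog
  mem : Mem

open Classical in
/-- One step of the machine. Every elementary operation and every evaluation of a test, on
expressions of a size fixed by the program, is one step, and so is every oracle query. A
configuration with empty stack has halted and does not change any more. -/
noncomputable def step {n m : ℕ} (v : Fin n → Finset (Fin m) → ℝ) : Config → PMF Config
  | ⟨[], μ⟩ => PMF.pure ⟨[], μ⟩
  | ⟨.skip :: k, μ⟩ => PMF.pure ⟨k, μ⟩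
  | ⟨.setNat a i e :: k, μ⟩ => PMF.pure ⟨k, μ.setNat a (i.eval μ) (e.eval μ)⟩
  | ⟨.setReal a i e :: k, μ⟩ => PMF.pure ⟨k, μ.setReal a (i.eval μ) (e.eval μ)⟩
  | ⟨.query a i g s :: k, μ⟩ =>
      PMF.pure ⟨k, μ.setReal a (i.eval μ) (oracle v μ (g.eval μ) s)⟩
  | ⟨.rand a i e :: k, μ⟩ =>
      (PMF.uniformOfFintype (Fin (e.eval μ + 1))).map fun r =>
        ⟨k, μ.setNat a (i.eval μ) r⟩
  | ⟨.seq c₁ c₂ :: k, μ⟩ => PMF.pure ⟨c₁ :: c₂ :: k, μ⟩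
  | ⟨.ite b c₁ c₂ :: k, μ⟩ => PMF.pure ⟨(if b.Holds μ then c₁ else c₂) :: k, μ⟩
  | ⟨.loop b c :: k, μ⟩ => PMF.pure ⟨if b.Holds μ then c :: .loop b c :: k else k, μ⟩

/-- The distribution of the configuration after `t` steps. -/
noncomputable def run {n m : ℕ} (v : Fin n → Finset (Fin m) → ℝ) : ℕ → Config → PMF Config
  | 0, c => PMF.pure c
  | t + 1, c => (step v c).bind (run v t)

/-- Start of program `P` on an instance with `m` items: the number `m` is stored at position `0` of
the natural-number array `0`, and everything else is `0`. -/
def start (P : Prog) (m : ℕ) : Config where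
  stack := [P]
  mem := { nat := fun a i => if a = 0 ∧ i = 0 then m else 0, real := fun _ _ => 0 }

/-- The machine has halted and the natural-number array `1` holds the allocation `A`: entry `j` is
the agent who gets item `j`. -/
def Outputs {n m : ℕ} (c : Config) (A : Fin m → Fin n) : Prop :=
  c.stack = [] ∧ ∀ j : Fin m, c.mem.nat 1 j = A j

end MaxMin

namespace MaxMin

/-! The algorithm is deterministic, so it succeeds with probability one: it runs a local search for
each of polynomially many guesses and keeps the best allocation. A guess consists of a target `τ`
and of at most `K` pinned items per agent. Agent `i` is measured by the shortfall `D_i(S) = max (τ -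
v_i(S)) 0`.

For a correct guess there is an allocation `O` with `v_i(O_i) ≥ τ` for all `i`, and the pins of `i`
are items of `O_i` after which every item of `O_i` changes `D_i` by at most `τ / K` (`exists_pins`).
With such small steps the `p`-th power is almost linear along one step: the additions of the single
items of `O_i` to a set decrease `D_i ^ p` by almost `p * D_i ^ p` in total
(`le_sum_shortfall_pow_sub`).

This gain rate allows the sum of the `D_i ^ p` to be reduced by a factor close to `e ^ (-p)`, by a
non-oblivious local search. Every unpinned item has an owner and one of `l` levels, and the
potential adds up weighted deficits over all agents and all sets `J` of levels. At an approximate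
local optimum the inequalities for moving each item `j` to the owner `O j`, at every level, are
added. The weights make the terms of all `J` cancel except those of the empty and of the full set
(`sum_levelWeight_cancel`). What remains is `∑ D_i(bundle) ^ p ≤ (1 + p / l) ^ (-l) * ∑ D_i(pins) ^
p` up to small errors (`LocalOpt.sum_le`), roughly at most `n * e ^ (-p) * τ ^ p`. So each `D_i` is
at most about `n ^ (1 / p) * τ / e`, and a large `p` turns the bound on a sum into one on the
maximum (`exists_parameters`, `LocalOpt.le_value`).

A suitable target lies on a grid spanned by a singleton value (`exists_target`). The potential is at
most a constant times `τ ^ p`, and every sweep short of a local optimum lowers it by `τ ^ p / (Q *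
(m + 1))`, so linearly many sweeps suffice (`wp_search`). All loops have iteration counts known in
advance, so the predicate `WP` gives correctness and running time together; `wp_algorithm` assembles
everything. -/

/-! ### Deficit functions and powers of the shortfall. -/

/-- Antitone set functions with diminishing decreases. -/
structure IsDeficit {M : Type*} [DecidableEq M] (E : Finset M → ℝ) : Prop where
  anti : ∀ A B, A ⊆ B → E B ≤ E A
  diminish : ∀ A B, A ⊆ B → ∀ g, E B - E (insert g B) ≤ E A - E (insert g A)

section SetFunctions

variable {M : Type*}

/-- The amount by which the value of a set falls short of the target `τ`. -/
noncomputable def shortfall (τ : ℝ) (f : Finset M → ℝ) (S : Finset M) : ℝ := max (τ - f S) 0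

theorem shortfall_nonneg (τ : ℝ) (f : Finset M → ℝ) (S : Finset M) : 0 ≤ shortfall τ f S :=
  le_max_right _ _

variable [DecidableEq M]

theorem IsDeficit.sub_union_le {E : Finset M → ℝ} (hE : IsDeficit E) (S O : Finset M) :
    E S - E (S ∪ O) ≤ ∑ j ∈ O, (E S - E (insert j S)) := by
  induction O using Finset.induction_on with
  | empty => simp
  | insert a O ha ih =>
    rw [Finset.sum_insert ha, Finset.union_insert]
    have := hE.diminish S (S ∪ O) Finset.subset_union_left a
    linarith

/-- When the items of `R` are removed one after the other, each removal takes place in a smaller set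
and costs at least as much as the same removal from `S`. -/
theorem IsDeficit.sum_erase_le {E : Finset M → ℝ} (hE : IsDeficit E) (S R : Finset M)
    (hR : R ⊆ S) : ∑ j ∈ R, (E (S.erase j) - E S) ≤ E (S \ R) - E S := by
  induction R using Finset.induction_on with
  | empty => simp
  | insert a R ha ih =>
    rw [Finset.sum_insert ha]
    have h1 := ih ((Finset.subset_insert a R).trans hR)
    have haS : a ∈ S := hR (Finset.mem_insert_self a R)
    have h2 := hE.diminish ((S \ R).erase a) (S.erase a)
      (Finset.erase_subset_erase a Finset.sdiff_subset) a
    rw [Finset.insert_erase haS, Finset.insert_erase (by simp [haS, ha])] at h2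
    have h3 : S \ insert a R = (S \ R).erase a := by
      ext x; simp only [Finset.mem_sdiff, Finset.mem_insert, Finset.mem_erase]; tauto
    rw [h3]; linarith

theorem shortfall_le {τ : ℝ} (hτ : 0 ≤ τ) {f : Finset M → ℝ} (hf : IsValuation f)
    (S : Finset M) : shortfall τ f S ≤ τ :=
  max_le (by linarith [hf.nonneg S]) hτ

theorem convexOn_max_sub_pow (τ : ℝ) (p : ℕ) :
    ConvexOn ℝ Set.univ (fun x : ℝ => max (τ - x) 0 ^ p) := by
  have h : ConvexOn ℝ Set.univ (fun x : ℝ => max (τ - x) 0) := by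
    have h1 : ConvexOn ℝ Set.univ (fun x : ℝ => τ - x) :=
      (convexOn_const τ convex_univ).sub (concaveOn_id convex_univ)
    exact h1.sup (convexOn_const 0 convex_univ)
  exact h.pow (fun x _ => le_max_right _ _) p

/-- Both `b` and `a + d` are convex combinations of `a` and `b + d`, with exchanged weights; the two
convexity inequalities are added. -/
theorem sub_le_sub_of_convexOn {ψ : ℝ → ℝ} (hψ : ConvexOn ℝ Set.univ ψ) {a b d : ℝ} (hab : a ≤ b)
    (hd : 0 ≤ d) : ψ b - ψ (b + d) ≤ ψ a - ψ (a + d) := by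
  rcases eq_or_lt_of_le hab with rfl | hab
  · exact le_rfl
  rcases eq_or_lt_of_le hd with rfl | hd
  · simp
  have hs : 0 < b - a + d := by linarith
  have hx : 0 ≤ d / (b - a + d) := by positivity
  have hy : 0 ≤ (b - a) / (b - a + d) := div_nonneg (by linarith) hs.le
  have hxy : d / (b - a + d) + (b - a) / (b - a + d) = 1 := by field_simp; ring
  have h1 := hψ.2 (Set.mem_univ a) (Set.mem_univ (b + d)) hx hy hxy
  have h2 := hψ.2 (Set.mem_univ a) (Set.mem_univ (b + d)) hy hx (by rw [add_comm, hxy])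
  have e1 : d / (b - a + d) * a + (b - a) / (b - a + d) * (b + d) = b := by field_simp; ring
  have e2 : (b - a) / (b - a + d) * a + d / (b - a + d) * (b + d) = a + d := by field_simp; ring
  have e3 : d / (b - a + d) = 1 - (b - a) / (b - a + d) := by field_simp; ring
  simp only [smul_eq_mul] at h1 h2
  rw [e1] at h1
  rw [e2] at h2
  rw [e3] at h1 h2
  linarith

/-- A convex decreasing function of a monotone submodular function has diminishing decreases. -/
theorem isDeficit_shortfall_pow (τ : ℝ) {f : Finset M → ℝ} (hf : IsValuation f) (p : ℕ) :
    IsDeficit (fun S => shortfall τ f S ^ p) where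
  anti A B h := pow_le_pow_left₀ (shortfall_nonneg _ _ _)
    (max_le_max (by linarith [hf.mono A B h]) le_rfl) p
  diminish A B h g := by
    by_cases hg : g ∈ B
    · simp only [Finset.insert_eq_of_mem hg, sub_self, sub_nonneg]
      exact pow_le_pow_left₀ (shortfall_nonneg _ _ _)
        (max_le_max (by linarith [hf.mono A _ (Finset.subset_insert g A)]) le_rfl) p
    · have h1 := hf.submodular A B h g hg
      have h2 := hf.mono B _ (Finset.subset_insert g B)
      -- Convexity transports the increment of `f` at `B` to the smaller value `f A`; submodularity
      -- then replaces it by the larger increment at `A`.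
      have h3 := sub_le_sub_of_convexOn (convexOn_max_sub_pow τ p) (hf.mono A B h)
        (sub_nonneg.2 h2)
      have h4 : shortfall τ f (insert g A) ^ p
          ≤ max (τ - (f A + (f (insert g B) - f B))) 0 ^ p :=
        pow_le_pow_left₀ (shortfall_nonneg _ _ _) (max_le_max (by linarith) le_rfl) p
      simp only [add_sub_cancel] at h3
      simp only [shortfall] at h4 ⊢
      linarith

theorem isDeficit_shortfall (τ : ℝ) {f : Finset M → ℝ} (hf : IsValuation f) :
    IsDeficit (shortfall τ f) := by
  simpa using isDeficit_shortfall_pow τ hf 1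

/-- This and the next lemma are the two mean value estimates, with the derivative taken at the lower
and at the upper end. -/
theorem mul_pow_le_pow_sub_pow {a b : ℝ} (hb : 0 ≤ b) (hab : b ≤ a) (p : ℕ) :
    (p + 1) * (a - b) * b ^ p ≤ a ^ (p + 1) - b ^ (p + 1) := by
  induction p with
  | zero => simp
  | succ p ih =>
    have h1 : b ^ p * (a - b) * b ≤ b ^ p * (a - b) * a :=
      mul_le_mul_of_nonneg_left hab (mul_nonneg (by positivity) (by linarith))
    have h2 := mul_le_mul_of_nonneg_left ih hb
    have h3 : b ^ (p + 1) ≤ a ^ (p + 1) := pow_le_pow_left₀ hb hab _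
    have h4 := mul_le_mul_of_nonneg_left h3 (sub_nonneg.2 hab)
    push_cast
    calc ((p : ℝ) + 1 + 1) * (a - b) * b ^ (p + 1)
        = b * ((p + 1) * (a - b) * b ^ p) + (a - b) * b ^ (p + 1) := by ring
      _ ≤ b * (a ^ (p + 1) - b ^ (p + 1)) + (a - b) * a ^ (p + 1) := by linarith
      _ = a ^ (p + 1 + 1) - b ^ (p + 1 + 1) := by ring

theorem pow_sub_pow_le_mul_pow {a b : ℝ} (hb : 0 ≤ b) (hab : b ≤ a) (p : ℕ) :
    a ^ (p + 1) - b ^ (p + 1) ≤ (p + 1) * (a - b) * a ^ p := by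
  induction p with
  | zero => simp
  | succ p ih =>
    have ha := hb.trans hab
    have h2 := mul_le_mul_of_nonneg_left ih ha
    have h3 : b ^ (p + 1) ≤ a ^ (p + 1) := pow_le_pow_left₀ hb hab _
    have h4 := mul_le_mul_of_nonneg_left h3 (sub_nonneg.2 hab)
    push_cast
    calc a ^ (p + 1 + 1) - b ^ (p + 1 + 1)
        = a * (a ^ (p + 1) - b ^ (p + 1)) + (a - b) * b ^ (p + 1) := by ring
      _ ≤ a * ((p + 1) * (a - b) * a ^ p) + (a - b) * a ^ (p + 1) := by linarith
      _ = ((p : ℝ) + 1 + 1) * (a - b) * a ^ (p + 1) := by ring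

/-- Adding single items of a set that reaches the target decreases the `p`-th power of the
shortfall by `p` times its value in total, provided that every item is small. -/
theorem le_sum_shortfall_pow_sub {τ θ : ℝ} (hτ : 0 ≤ τ) (hθ : 0 ≤ θ) {f : Finset M → ℝ}
    (hf : IsValuation f) (S O : Finset M) (hO : τ ≤ f O) {p : ℕ} (hp : 1 ≤ p)
    (hsmall : ∀ j ∈ O, shortfall τ f S - shortfall τ f (insert j S) ≤ θ * τ) :
    p * shortfall τ f S ^ p - p ^ 2 * θ * τ ^ p
      ≤ ∑ j ∈ O, (shortfall τ f S ^ p - shortfall τ f (insert j S) ^ p) := by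
  obtain ⟨q, rfl⟩ : ∃ q, p = q + 1 := ⟨p - 1, by omega⟩
  set D := shortfall τ f S with hD
  have hD0 : 0 ≤ D := shortfall_nonneg _ _ _
  have hDτ : D ≤ τ := shortfall_le hτ hf S
  have hE := isDeficit_shortfall τ hf
  have hsum : D ≤ ∑ j ∈ O, (D - shortfall τ f (insert j S)) := by
    have h := hE.sub_union_le S O
    have h0 : shortfall τ f (S ∪ O) = 0 :=
      max_eq_right (by linarith [hf.mono O (S ∪ O) Finset.subset_union_right])
    rw [h0, sub_zero] at h
    exact h
  -- No single item of `O` brings the shortfall below `X`, so `(q + 1) * X ^ q` bounds the slope of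
  -- the power along each addition from below. Replacing `X` by `D` afterwards costs the error term.
  set X := max (D - θ * τ) 0 with hX
  have hX0 : 0 ≤ X := le_max_right _ _
  have hXD : X ≤ D := max_le (by nlinarith) hD0
  have hθτ : 0 ≤ θ * τ := mul_nonneg hθ hτ
  have hDX : D - X ≤ θ * τ := by linarith [le_max_left (D - θ * τ) 0]
  have hterm : ∀ j ∈ O, ((q : ℝ) + 1) * X ^ q * (D - shortfall τ f (insert j S))
      ≤ D ^ (q + 1) - shortfall τ f (insert j S) ^ (q + 1) := by
    intro j hj
    have h0 := shortfall_nonneg τ f (insert j S)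
    have h1 : shortfall τ f (insert j S) ≤ D := hE.anti _ _ (Finset.subset_insert _ _)
    have h2 := mul_pow_le_pow_sub_pow h0 h1 q
    have h3 : X ≤ shortfall τ f (insert j S) := max_le (by linarith [hsmall j hj]) h0
    refine le_trans ?_ h2
    have h4 : X ^ q ≤ shortfall τ f (insert j S) ^ q := pow_le_pow_left₀ hX0 h3 q
    have h5 := mul_le_mul_of_nonneg_left h4
      (mul_nonneg (by positivity : (0 : ℝ) ≤ q + 1) (sub_nonneg.2 h1))
    linarith
  have h1 := Finset.sum_le_sum hterm
  rw [← Finset.mul_sum] at h1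
  have hc : 0 ≤ ((q : ℝ) + 1) * X ^ q := by positivity
  have h2 := mul_le_mul_of_nonneg_left hsum hc
  have h3 := mul_le_mul_of_nonneg_left hXD hc
  have h4 := pow_sub_pow_le_mul_pow hX0 hXD q
  have h5 : ((q : ℝ) + 1) * (D - X) * D ^ q ≤ (q + 1) * (θ * τ) * τ ^ q := by
    gcongr
  have h6 : ((q : ℝ) + 1) * (D ^ (q + 1) - X ^ (q + 1)) ≤ (q + 1) * ((q + 1) * (θ * τ) * τ ^ q) :=
    mul_le_mul_of_nonneg_left (h4.trans h5) (by positivity)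
  push_cast
  have e1 : ((q : ℝ) + 1) * X ^ q * X = (q + 1) * X ^ (q + 1) := by ring
  have e2 : ((q : ℝ) + 1) * ((q + 1) * (θ * τ) * τ ^ q) = (q + 1) ^ 2 * θ * τ ^ (q + 1) := by ring
  linarith

/-- A few items of `O` make all other items of `O` small. -/
theorem exists_pins {τ : ℝ} (hτ : 0 < τ) {f : Finset M → ℝ} (hf : IsValuation f) (O : Finset M)
    {K : ℕ} (hK : 0 < K) :
    ∃ B ⊆ O, B.card ≤ K ∧ ∀ j ∈ O, ∀ S, B ⊆ S →
      shortfall τ f S - shortfall τ f (insert j S) ≤ 1 / K * τ := by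
  have hKr : (0 : ℝ) < K := by exact_mod_cast hK
  have hE := isDeficit_shortfall τ hf
  -- `B` is a largest set whose items reduce the shortfall by `τ / K` each on average. Another item
  -- with a larger decrease could be added to `B`, and more than `K` items would reduce the
  -- shortfall by more than `τ`.
  let C := O.powerset.filter fun B => (B.card : ℝ) * (1 / K * τ) ≤ τ - shortfall τ f B
  have hC : C.Nonempty := ⟨∅, by simp [C, shortfall, hf.empty, hτ.le]⟩
  obtain ⟨B, hB, hmax⟩ := C.exists_max_image Finset.card hC
  simp only [C, Finset.mem_filter, Finset.mem_powerset] at hB hmax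
  refine ⟨B, hB.1, ?_, ?_⟩
  · have h := hB.2
    have h0 := shortfall_nonneg τ f B
    have h1 : (B.card : ℝ) * (1 / K * τ) ≤ τ := by linarith
    have h2 : (B.card : ℝ) ≤ K := by
      have : (B.card : ℝ) * (1 / K * τ) = (B.card / K) * τ := by ring
      rw [this] at h1
      have h3 : (B.card : ℝ) / K ≤ 1 := by
        by_contra hcon
        push Not at hcon
        nlinarith
      rwa [div_le_one hKr] at h3
    exact_mod_cast h2
  · intro j hj S hS
    refine (hE.diminish B S hS j).trans ?_
    by_contra hcon
    push Not at hcon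
    have hjB : j ∉ B := by
      intro hjB
      rw [Finset.insert_eq_of_mem hjB, sub_self] at hcon
      have : 0 < 1 / (K : ℝ) * τ := by positivity
      linarith
    have h := hmax (insert j B) ⟨Finset.insert_subset hj hB.1, ?_⟩
    · rw [Finset.card_insert_of_notMem hjB] at h
      omega
    · rw [Finset.card_insert_of_notMem hjB]
      push_cast
      linarith [hB.2]

end SetFunctions

/-! ## The potential of the local search -/

/-- The weight of a set of `s` levels in the potential. -/
def levelWeight (l p s : ℕ) : ℕ :=
  (l + p) ^ (s - 1) * l ^ (l - s) * (s - 1).factorial * (l - s).factorial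

/-- This recursion defines the weights: it makes the coefficient of every `J` with `0 < J.card < l`
vanish in `sum_levelWeight_cancel`. -/
theorem levelWeight_succ {l p s : ℕ} (hs : 1 ≤ s) (hsl : s < l) :
    levelWeight l p (s + 1) * (l - s) * l = levelWeight l p s * s * (l + p) := by
  obtain ⟨r, rfl⟩ : ∃ r, s = r + 1 := ⟨s - 1, by omega⟩
  obtain ⟨q, rfl⟩ : ∃ q, l = r + 1 + (q + 1) := ⟨l - (r + 1) - 1, by omega⟩
  have h1 : r + 1 + (q + 1) - (r + 1 + 1) = q := by omega
  have h2 : r + 1 + (q + 1) - (r + 1) = q + 1 := by omega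
  simp only [levelWeight, h1, h2, Nat.add_sub_cancel, Nat.factorial_succ]
  ring

/-- Double counting: pairs of a set with one of its elements correspond to pairs of a set with an
element outside it. -/
theorem sum_powerset_sum_erase {N : Finset ℕ} (w : ℕ → ℝ) (F : Finset ℕ → ℝ) :
    ∑ J ∈ N.powerset, w J.card * ∑ k ∈ J, F (J.erase k)
      = ∑ J ∈ N.powerset, w (J.card + 1) * (N.card - J.card : ℝ) * F J := by
  have h1 : ∀ J ∈ N.powerset, w (J.card + 1) * (N.card - J.card : ℝ) * F J
      = ∑ k ∈ N \ J, w (J.card + 1) * F J := by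
    intro J hJ
    rw [Finset.sum_const, Finset.card_sdiff_of_subset (Finset.mem_powerset.1 hJ), nsmul_eq_mul,
      Nat.cast_sub (Finset.card_le_card (Finset.mem_powerset.1 hJ))]
    ring
  rw [Finset.sum_congr rfl h1]
  simp_rw [Finset.mul_sum]
  rw [Finset.sum_sigma', Finset.sum_sigma']
  refine Finset.sum_bij' (fun x _ => ⟨x.1.erase x.2, x.2⟩) (fun x _ => ⟨insert x.2 x.1, x.2⟩)
    ?_ ?_ ?_ ?_ ?_
  · rintro ⟨J, k⟩ h
    simp only [Finset.mem_sigma, Finset.mem_powerset, Finset.mem_sdiff] at h ⊢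
    exact ⟨(Finset.erase_subset _ _).trans h.1, h.1 h.2, Finset.notMem_erase _ _⟩
  · rintro ⟨J, k⟩ h
    simp only [Finset.mem_sigma, Finset.mem_powerset, Finset.mem_sdiff] at h ⊢
    exact ⟨Finset.insert_subset h.2.1 h.1, Finset.mem_insert_self _ _⟩
  · rintro ⟨J, k⟩ h
    simp only [Finset.mem_sigma] at h
    simp [Finset.insert_erase h.2]
  · rintro ⟨J, k⟩ h
    simp only [Finset.mem_sigma, Finset.mem_sdiff] at h
    simp [Finset.erase_insert h.2.2]
  · rintro ⟨J, k⟩ h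
    simp only [Finset.mem_sigma] at h
    have : (J.erase k).card + 1 = J.card := Finset.card_erase_add_one h.2
    simp [this]

/-- The left side is the combination of deficits produced by adding the local optimality conditions.
A set of size `s` has the coefficient `w s * s * (l + p) - l * w (s + 1) * (l - s)`. The weight of
the empty set, where `s - 1` is truncated, never contributes. -/
theorem sum_levelWeight_cancel {l p : ℕ} (hl : 1 ≤ l) (F : Finset ℕ → ℝ) :
    ∑ J ∈ (Finset.range l).powerset, (levelWeight l p J.card : ℝ) * J.card * (l + p) * F J
      - l * ∑ J ∈ (Finset.range l).powerset,
          (levelWeight l p J.card : ℝ) * ∑ k ∈ J, F (J.erase k)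
      = (l + p) ^ l * l.factorial * F (Finset.range l) - l ^ l * l.factorial * F ∅ := by
  rw [sum_powerset_sum_erase (fun s => (levelWeight l p s : ℝ)), Finset.mul_sum,
    ← Finset.sum_sub_distrib]
  have hne : (∅ : Finset ℕ) ≠ Finset.range l := by
    intro h
    have := congrArg Finset.card h
    simp at this
    omega
  rw [← Finset.sum_subset (s₁ := {∅, Finset.range l})]
  · rw [Finset.sum_pair hne]
    obtain ⟨q, rfl⟩ : ∃ q, l = q + 1 := ⟨l - 1, by omega⟩
    simp [levelWeight, Nat.factorial_succ]
    ring
  · intro J hJ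
    simp only [Finset.mem_insert, Finset.mem_singleton] at hJ
    rcases hJ with rfl | rfl <;> simp
  · intro J hJ hJ'
    simp only [Finset.mem_insert, Finset.mem_singleton, not_or] at hJ'
    have hsub := Finset.mem_powerset.1 hJ
    have h1 : 1 ≤ J.card := Finset.card_pos.2 (Finset.nonempty_iff_ne_empty.2 hJ'.1)
    have h2 : J.card < l := by
      simpa using Finset.card_lt_card (Finset.ssubset_iff_subset_ne.2 ⟨hsub, hJ'.2⟩)
    have h3 := levelWeight_succ (p := p) h1 h2
    have h4 : (levelWeight l p (J.card + 1) : ℝ) * (l - J.card) * l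
        = levelWeight l p J.card * J.card * (l + p) := by
      rw [← Nat.cast_sub h2.le]; exact_mod_cast h3
    rw [Finset.card_range, ← h4]
    ring

section Potential

variable {M : Type*} [Fintype M] [DecidableEq M]

/-- The items that agent `i` owns at the levels in `J`. Items of level at least `l` are pinned and
count for every `J`. -/
def part (l : ℕ) (ag lev : M → ℕ) (i : ℕ) (J : Finset ℕ) : Finset M :=
  Finset.univ.filter fun j => ag j = i ∧ (l ≤ lev j ∨ lev j ∈ J)

/-- The potential. -/
def potential {n : ℕ} (l p : ℕ) (E : Fin n → Finset M → ℝ) (ag lev : M → ℕ) : ℝ :=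
  ∑ i : Fin n, ∑ J ∈ (Finset.range l).powerset,
    (levelWeight l p J.card : ℝ) * E i (part l ag lev i J)

/-- No move of a single item that is not pinned decreases the potential by `η`. -/
def LocalOpt {n : ℕ} (l p : ℕ) (E : Fin n → Finset M → ℝ) (η : ℝ) (ag lev : M → ℕ) : Prop :=
  ∀ j, lev j < l → ∀ i < n, ∀ k < l, potential l p E ag lev
    < potential l p E (Function.update ag j i) (Function.update lev j k) + η

theorem part_move {l : ℕ} {ag lev : M → ℕ} {j : M} (hj : lev j < l) {i k : ℕ} (hk : k < l)
    (i' : ℕ) (J : Finset ℕ) :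
    part l (Function.update ag j i) (Function.update lev j k) i' J
      = if i' = i ∧ k ∈ J then insert j (part l ag lev i' J) else (part l ag lev i' J).erase j := by
  ext x
  by_cases hx : x = j
  · subst hx
    split_ifs with h
    · simp [part, h.1, h.2]
    · simp [part, hk]
      tauto
  · split_ifs <;> simp [part, hx]

/-- The item is first removed everywhere and then inserted at its new place. In the parts that
receive it the removal is charged as well, which only weakens the bound. -/
theorem potential_move_le {n l p : ℕ} {E : Fin n → Finset M → ℝ} (hE : ∀ i, IsDeficit (E i))
    {ag lev : M → ℕ} {j : M} (hj : lev j < l) (i : Fin n) {k : ℕ} (hk : k < l) :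
    potential l p E (Function.update ag j i) (Function.update lev j k)
      ≤ potential l p E ag lev
        + (∑ i : Fin n, ∑ J ∈ (Finset.range l).powerset, (levelWeight l p J.card : ℝ) *
            (E i ((part l ag lev i J).erase j) - E i (part l ag lev i J)))
        - ∑ J ∈ (Finset.range l).powerset, if k ∈ J then (levelWeight l p J.card : ℝ) *
            (E i (part l ag lev i J) - E i (insert j (part l ag lev i J))) else 0 := by
  have h0 : (∑ J ∈ (Finset.range l).powerset, if k ∈ J then (levelWeight l p J.card : ℝ) *
            (E i (part l ag lev i J) - E i (insert j (part l ag lev i J))) else 0)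
      = ∑ i' : Fin n, ∑ J ∈ (Finset.range l).powerset,
          if i' = i ∧ k ∈ J then (levelWeight l p J.card : ℝ) *
            (E i' (part l ag lev i' J) - E i' (insert j (part l ag lev i' J))) else 0 := by
    rw [Finset.sum_eq_single i]
    · simp
    · intro i' _ hi'
      simp [hi']
    · simp
  rw [h0, potential, potential, ← Finset.sum_add_distrib, ← Finset.sum_sub_distrib]
  refine Finset.sum_le_sum fun i' _ => ?_
  rw [← Finset.sum_add_distrib, ← Finset.sum_sub_distrib]
  refine Finset.sum_le_sum fun J _ => ?_
  rw [part_move hj hk]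
  have hw : (0 : ℝ) ≤ levelWeight l p J.card := Nat.cast_nonneg _
  simp only [Fin.val_inj]
  split_ifs with h
  · have h1 := (hE i').anti _ _ (Finset.erase_subset j (part l ag lev i' J))
    have h2 := mul_nonneg hw (sub_nonneg.2 h1)
    linarith
  · linarith

theorem part_sdiff_level {l : ℕ} {ag lev : M → ℕ} {i k : ℕ} {J : Finset ℕ} (hk : k < l) :
    part l ag lev i J \ (Finset.univ.filter fun j => ag j = i ∧ lev j = k)
      = part l ag lev i (J.erase k) := by
  ext x
  simp only [part, Finset.mem_sdiff, Finset.mem_filter, Finset.mem_univ, true_and,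
    Finset.mem_erase]
  constructor
  · rintro ⟨⟨h1, h2⟩, h3⟩
    refine ⟨h1, h2.imp_right fun h => ⟨fun h' => h3 ⟨h1, h'⟩, h⟩⟩
  · rintro ⟨h1, h2⟩
    exact ⟨⟨h1, h2.imp_right fun h => h.2⟩, fun h => h2.elim (fun h' => by omega) fun h' => h'.1 h.2⟩

/-- The unpinned items of the part fall into the levels `k ∈ J`. Removing level `k` entirely leaves
the part of `J.erase k`, so `IsDeficit.sum_erase_le` applies level by level. -/
theorem sum_erase_part_le {l : ℕ} {E : Finset M → ℝ} (hE : IsDeficit E) (ag lev : M → ℕ) (i : ℕ)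
    {J : Finset ℕ} (hJ : J ⊆ Finset.range l) :
    ∑ j with lev j < l, (E ((part l ag lev i J).erase j) - E (part l ag lev i J))
      ≤ ∑ k ∈ J, (E (part l ag lev i (J.erase k)) - E (part l ag lev i J)) := by
  have h1 : ∑ j with lev j < l, (E ((part l ag lev i J).erase j) - E (part l ag lev i J))
      = ∑ j ∈ J.biUnion fun k => Finset.univ.filter fun j => ag j = i ∧ lev j = k,
        (E ((part l ag lev i J).erase j) - E (part l ag lev i J)) := by
    symm
    apply Finset.sum_subset
    · intro j hj
      simp only [Finset.mem_biUnion, Finset.mem_filter, Finset.mem_univ, true_and] at hj ⊢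
      obtain ⟨k, hk, -, rfl⟩ := hj
      exact Finset.mem_range.1 (hJ hk)
    · intro j hj hj'
      simp only [Finset.mem_biUnion, Finset.mem_filter, Finset.mem_univ, true_and] at hj hj'
      rw [Finset.erase_eq_of_notMem, sub_self]
      simp only [part, Finset.mem_filter, Finset.mem_univ, true_and, not_and, not_or]
      intro h
      exact ⟨by omega, fun h' => hj' ⟨_, h', h, rfl⟩⟩
  rw [h1, Finset.sum_biUnion]
  · refine Finset.sum_le_sum fun k hk => ?_
    rw [← part_sdiff_level (Finset.mem_range.1 (hJ hk))]
    refine hE.sum_erase_le _ _ fun j hj => ?_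
    simp only [part, Finset.mem_filter, Finset.mem_univ, true_and] at hj ⊢
    exact ⟨hj.1, Or.inr (hj.2 ▸ hk)⟩
  · intro k _ k' _ hkk'
    simp only [Function.onFun]
    rw [Finset.disjoint_left]
    intro j hj hj'
    simp only [Finset.mem_filter, Finset.mem_univ, true_and] at hj hj'
    exact hkk' (hj.2.symm.trans hj'.2)

/-- At a local optimum the total deficit of the bundles is bounded by the total deficit of the
pinned items. -/
theorem LocalOpt.sum_le {n l p : ℕ} (hl : 1 ≤ l) {E : Fin n → Finset M → ℝ}
    (hE : ∀ i, IsDeficit (E i)) {η δ : ℝ} (hη : 0 ≤ η) {ag lev : M → ℕ}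
    (hopt : LocalOpt l p E η ag lev) (O : M → Fin n) (hpin : ∀ j, l ≤ lev j → ag j = O j)
    (hgain : ∀ i, ∀ J ⊆ Finset.range l, p * E i (part l ag lev i J) - δ
      ≤ ∑ j with O j = i, (E i (part l ag lev i J) - E i (insert j (part l ag lev i J)))) :
    (l + p) ^ l * l.factorial * ∑ i, E i (part l ag lev i (Finset.range l))
      ≤ l ^ l * l.factorial * ∑ i, E i (part l ag lev i ∅)
        + n * (∑ J ∈ (Finset.range l).powerset, (levelWeight l p J.card : ℝ) * J.card) * δ
        + Fintype.card M * l * η := by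
  set w : Finset ℕ → ℝ := fun J => (levelWeight l p J.card : ℝ) with hw
  have hw0 : ∀ J, 0 ≤ w J := fun J => Nat.cast_nonneg _
  set X : Fin n → Finset ℕ → ℝ := fun i J => E i (part l ag lev i J) with hX
  set gain : M → Fin n → Finset ℕ → ℝ := fun j i J =>
    X i J - E i (insert j (part l ag lev i J)) with hgaindef
  set loss : M → Fin n → Finset ℕ → ℝ := fun j i J =>
    E i ((part l ag lev i J).erase j) - X i J with hlossdef
  set P := (Finset.range l).powerset with hP
  -- summing the inequalities of all moves towards `O`
  have hmove : ∀ j, lev j < l → ∀ k ∈ Finset.range l,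
      (∑ J ∈ P, if k ∈ J then w J * gain j (O j) J else 0)
        ≤ (∑ i, ∑ J ∈ P, w J * loss j i J) + η := by
    intro j hj k hk
    have h1 := hopt j hj (O j) (O j).2 k (Finset.mem_range.1 hk)
    have h2 := potential_move_le (p := p) hE (ag := ag) hj (O j) (Finset.mem_range.1 hk)
    simp only [hgaindef, hlossdef, hX, hw]
    linarith
  -- When the new level ranges over all levels, the gain at `J` is counted once for every element of
  -- `J`.
  have hgain1 : ∀ j, (∑ k ∈ Finset.range l, ∑ J ∈ P, if k ∈ J then w J * gain j (O j) J else 0)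
      = ∑ J ∈ P, w J * J.card * gain j (O j) J := by
    intro j
    rw [Finset.sum_comm]
    refine Finset.sum_congr rfl fun J hJ => ?_
    rw [← Finset.sum_filter, Finset.sum_const, Finset.filter_mem_eq_inter,
      Finset.inter_eq_right.2 (Finset.mem_powerset.1 hJ), nsmul_eq_mul]
    ring
  have hsum1 : ∀ j, lev j < l → ∑ J ∈ P, w J * J.card * gain j (O j) J
      ≤ l * (∑ i, ∑ J ∈ P, w J * loss j i J) + l * η := by
    intro j hj
    rw [← hgain1]
    have h := Finset.sum_le_sum (hmove j hj)
    rw [Finset.sum_const, Finset.card_range, nsmul_eq_mul] at h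
    linarith
  have hsum2 : ∑ j with lev j < l, ∑ J ∈ P, w J * J.card * gain j (O j) J
      ≤ l * (∑ i, ∑ J ∈ P, w J * ∑ j with lev j < l, loss j i J)
        + Fintype.card M * (l * η) := by
    have h := Finset.sum_le_sum (s := Finset.univ.filter fun j => lev j < l)
      (fun j hj => hsum1 j (Finset.mem_filter.1 hj).2)
    rw [Finset.sum_add_distrib, ← Finset.mul_sum, Finset.sum_const, nsmul_eq_mul] at h
    have hc : ((Finset.univ.filter fun j => lev j < l).card : ℝ) ≤ Fintype.card M := by
      exact_mod_cast Finset.card_filter_le _ _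
    have hc' := mul_le_mul_of_nonneg_right hc (by positivity : 0 ≤ (l : ℝ) * η)
    have e : ∑ j with lev j < l, ∑ i, ∑ J ∈ P, w J * loss j i J
        = ∑ i, ∑ J ∈ P, w J * ∑ j with lev j < l, loss j i J := by
      rw [Finset.sum_comm]
      refine Finset.sum_congr rfl fun i _ => ?_
      rw [Finset.sum_comm]
      refine Finset.sum_congr rfl fun J _ => ?_
      rw [Finset.mul_sum]
    rw [e] at h
    linarith
  have hlow : ∑ i, ∑ J ∈ P, w J * J.card * (p * X i J - δ)
      ≤ ∑ j with lev j < l, ∑ J ∈ P, w J * J.card * gain j (O j) J := by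
    have e : ∑ j with lev j < l, ∑ J ∈ P, w J * J.card * gain j (O j) J
        = ∑ i, ∑ J ∈ P, w J * J.card * ∑ j with O j = i, gain j i J := by
      -- A pinned item already lies in every part of its owner in `O`, so its gain is zero and the
      -- sum extends to all items.
      have e1 : ∑ j with lev j < l, ∑ J ∈ P, w J * J.card * gain j (O j) J
          = ∑ j, ∑ J ∈ P, w J * J.card * gain j (O j) J := by
        apply Finset.sum_subset (Finset.filter_subset _ _)
        intro j _ hj
        simp only [Finset.mem_filter, Finset.mem_univ, true_and, not_lt] at hj
        refine Finset.sum_eq_zero fun J _ => ?_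
        have : j ∈ part l ag lev (O j) J := by
          simp [part, hpin j hj, hj]
        simp [hgaindef, hX, Finset.insert_eq_of_mem this]
      rw [e1, ← Finset.sum_fiberwise (s := Finset.univ) (g := O)]
      refine Finset.sum_congr rfl fun i _ => ?_
      rw [Finset.sum_comm]
      refine Finset.sum_congr rfl fun J _ => ?_
      rw [Finset.mul_sum]
      refine Finset.sum_congr rfl fun j hj => ?_
      rw [(Finset.mem_filter.1 hj).2]
    rw [e]
    refine Finset.sum_le_sum fun i _ => Finset.sum_le_sum fun J hJ => ?_
    exact mul_le_mul_of_nonneg_left (hgain i J (Finset.mem_powerset.1 hJ))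
      (mul_nonneg (hw0 J) (Nat.cast_nonneg _))
  have hhigh : ∑ i, ∑ J ∈ P, w J * ∑ j with lev j < l, loss j i J
      ≤ ∑ i, ∑ J ∈ P, w J * ∑ k ∈ J, (X i (J.erase k) - X i J) := by
    refine Finset.sum_le_sum fun i _ => Finset.sum_le_sum fun J hJ => ?_
    exact mul_le_mul_of_nonneg_left
      (sum_erase_part_le (hE i) ag lev i (Finset.mem_powerset.1 hJ)) (hw0 J)
  have hmain := hlow.trans (hsum2.trans (add_le_add_left
    (mul_le_mul_of_nonneg_left hhigh (Nat.cast_nonneg l)) _))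
  have hcancel : ∀ i, (l + p) ^ l * l.factorial * X i (Finset.range l)
      = l ^ l * l.factorial * X i ∅
        + (∑ J ∈ P, w J * J.card * (p * X i J - δ)) + (∑ J ∈ P, w J * J.card) * δ
        - l * ∑ J ∈ P, w J * ∑ k ∈ J, (X i (J.erase k) - X i J) := by
    intro i
    have h := sum_levelWeight_cancel (p := p) hl (X i)
    have e1 : ∑ J ∈ P, w J * ∑ k ∈ J, (X i (J.erase k) - X i J)
        = ∑ J ∈ P, w J * ∑ k ∈ J, X i (J.erase k) - ∑ J ∈ P, w J * J.card * X i J := by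
      rw [← Finset.sum_sub_distrib]
      refine Finset.sum_congr rfl fun J _ => ?_
      rw [Finset.sum_sub_distrib, Finset.sum_const, nsmul_eq_mul]
      ring
    have e2 : ∑ J ∈ P, w J * J.card * (p * X i J - δ)
        = p * ∑ J ∈ P, w J * J.card * X i J - (∑ J ∈ P, w J * J.card) * δ := by
      rw [Finset.mul_sum, Finset.sum_mul, ← Finset.sum_sub_distrib]
      refine Finset.sum_congr rfl fun J _ => ?_
      ring
    have e3 : ∑ J ∈ P, w J * J.card * (l + p) * X i J
        = (l + p) * ∑ J ∈ P, w J * J.card * X i J := by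
      rw [Finset.mul_sum]
      refine Finset.sum_congr rfl fun J _ => ?_
      ring
    rw [e1, e2]
    rw [e3] at h
    linarith
  have htotal : (l + p) ^ l * l.factorial * ∑ i, X i (Finset.range l)
      = l ^ l * l.factorial * ∑ i, X i ∅
        + (∑ i, ∑ J ∈ P, w J * J.card * (p * X i J - δ)) + n * (∑ J ∈ P, w J * J.card) * δ
        - l * ∑ i, ∑ J ∈ P, w J * ∑ k ∈ J, (X i (J.erase k) - X i J) := by
    rw [Finset.mul_sum, Finset.sum_congr rfl fun i _ => hcancel i]
    have aux : ∀ (a b c : ℝ) (x y z : Fin n → ℝ), ∑ i, (a * x i + y i + c - b * z i)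
        = a * ∑ i, x i + ∑ i, y i + n * c - b * ∑ i, z i := by
      intro a b c x y z
      simp [Finset.sum_add_distrib, Finset.sum_sub_distrib, ← Finset.mul_sum]
    rw [aux, mul_assoc (n : ℝ)]
  simp only [hX, hw] at htotal hmain ⊢
  linarith

end Potential

/-! ## Parameters and the approximation guarantee -/

/-- The ratio between the final shortfall and the target. -/
noncomputable def gap (ε : ℝ) : ℝ := 1 / Real.exp 1 + ε / 2

theorem gap_pos {ε : ℝ} (hε : 0 < ε) : 0 < gap ε := by
  unfold gap; positivity

theorem exists_nat_div_le (a : ℝ) {b : ℝ} (hb : 0 < b) : ∃ K : ℕ, 0 < K ∧ a / K ≤ b := by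
  obtain ⟨K, hK⟩ := exists_nat_gt (max (a / b) 0)
  have h0 : (0 : ℝ) < K := (le_max_right _ _).trans_lt hK
  have h1 : a / b < K := (le_max_left _ _).trans_lt hK
  refine ⟨K, by exact_mod_cast h0, ?_⟩
  rw [div_lt_iff₀ hb] at h1
  rw [div_le_iff₀ h0]
  linarith

/-- The order of the choices matters. As `gap ε * e > 1`, a large `p` makes `(gap ε * e) ^ p` exceed
`2 * n`; then `l` is taken so large that `(1 + p / l) ^ l` is close enough to `e ^ p`. This settles
the main term with half of the right side, and `K` and `Q` keep the two errors below a quarter each.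
-/
theorem exists_parameters (n : ℕ) {ε : ℝ} (hε : 0 < ε) :
    ∃ p l K Q N : ℕ, 1 ≤ p ∧ 1 ≤ l ∧ 0 < K ∧ 0 < Q ∧ 0 < N ∧ 1 / (N : ℝ) ≤ ε / 2 ∧
      (n * ((l : ℝ) ^ l * l.factorial)
        + n * (∑ J ∈ (Finset.range l).powerset, (levelWeight l p J.card : ℝ) * J.card)
            * (p ^ 2 * (1 / K)) + l / Q)
        ≤ gap ε ^ p * (((l : ℝ) + p) ^ l * l.factorial) := by
  have hg := gap_pos hε
  have h1 : 1 < gap ε * Real.exp 1 := by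
    have he := Real.exp_pos 1
    have : gap ε * Real.exp 1 = 1 + ε / 2 * Real.exp 1 := by
      unfold gap; field_simp
    rw [this]
    have : 0 < ε / 2 * Real.exp 1 := by positivity
    linarith
  obtain ⟨p, hp, hp1⟩ := (((tendsto_pow_atTop_atTop_of_one_lt h1).eventually_gt_atTop
    (2 * (n : ℝ))).and (Filter.eventually_ge_atTop 1)).exists
  have h2 : 2 * n / gap ε ^ p < Real.exp p := by
    rw [div_lt_iff₀ (by positivity)]
    rw [mul_pow, ← Real.exp_nat_mul, mul_one] at hp
    linarith
  obtain ⟨l, hl, hl1⟩ := (((Real.tendsto_one_add_div_pow_exp (p : ℝ)).eventually_const_lt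
    h2).and (Filter.eventually_ge_atTop 1)).exists
  have hl0 : (0 : ℝ) < l := by exact_mod_cast hl1
  have h3 : 2 * n * (l : ℝ) ^ l ≤ gap ε ^ p * ((l : ℝ) + p) ^ l := by
    rw [div_lt_iff₀ (by positivity)] at hl
    have e : (1 + (p : ℝ) / l) ^ l * l ^ l = (l + p) ^ l := by
      rw [← mul_pow]; congr 1; field_simp
    have := mul_le_mul_of_nonneg_right hl.le (by positivity : 0 ≤ (l : ℝ) ^ l)
    rw [← e]
    linarith
  set R := gap ε ^ p * (((l : ℝ) + p) ^ l * l.factorial) with hR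
  have hR0 : 0 < R := by positivity
  set A := ∑ J ∈ (Finset.range l).powerset, (levelWeight l p J.card : ℝ) * J.card
  obtain ⟨K, hK, hK'⟩ := exists_nat_div_le (n * A * p ^ 2) (by linarith : 0 < R / 4)
  obtain ⟨Q, hQ, hQ'⟩ := exists_nat_div_le l (by linarith : 0 < R / 4)
  obtain ⟨N, hN, hN'⟩ := exists_nat_div_le 1 (by linarith : 0 < ε / 2)
  refine ⟨p, l, K, Q, N, hp1, hl1, hK, hQ, hN, hN', ?_⟩
  have h4 : n * ((l : ℝ) ^ l * l.factorial) ≤ R / 2 := by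
    have := mul_le_mul_of_nonneg_right h3 (by positivity : (0 : ℝ) ≤ l.factorial)
    rw [hR]
    linarith
  have h5 : n * A * (p ^ 2 * (1 / (K : ℝ))) = n * A * p ^ 2 / K := by ring
  rw [h5]
  linarith

section Guarantee

variable {n m : ℕ}

/-- The deficits in the potential of the algorithm. -/
noncomputable def deficit (v : Fin n → Finset (Fin m) → ℝ) (τ : ℝ) (p : ℕ) (i : Fin n)
    (S : Finset (Fin m)) : ℝ := shortfall τ (v i) S ^ p

/-- The least decrease of the potential for which an item is moved. -/
noncomputable def threshold (m Q p : ℕ) (τ : ℝ) : ℝ := τ ^ p / (Q * (m + 1))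

/-- The `p`-th power of one agent's shortfall is at most the sum over all agents, so the bound `(γ *
τ) ^ p` on the sum bounds each shortfall by `γ * τ`. -/
theorem LocalOpt.le_value {v : Fin n → Finset (Fin m) → ℝ} (hv : ∀ i, IsValuation (v i))
    {τ γ : ℝ} (hτ : 0 < τ) (hγ : 0 ≤ γ) {p l K Q : ℕ} (hp : 1 ≤ p) (hl : 1 ≤ l) (hQ : 0 < Q)
    (hpar : (n * ((l : ℝ) ^ l * l.factorial)
        + n * (∑ J ∈ (Finset.range l).powerset, (levelWeight l p J.card : ℝ) * J.card)
            * (p ^ 2 * (1 / K)) + l / Q) ≤ γ ^ p * (((l : ℝ) + p) ^ l * l.factorial))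
    {O : Fin m → Fin n} (hO : ∀ i, τ ≤ v i (bundle O i)) {B : Fin n → Finset (Fin m)}
    (hB : ∀ i, ∀ j ∈ bundle O i, ∀ S, B i ⊆ S →
      shortfall τ (v i) S - shortfall τ (v i) (insert j S) ≤ 1 / K * τ)
    {ag lev : Fin m → ℕ} (hpin : ∀ j, l ≤ lev j → ag j = O j)
    (hBpin : ∀ i, ∀ j ∈ B i, ag j = i ∧ l ≤ lev j)
    (hopt : LocalOpt l p (deficit v τ p) (threshold m Q p τ) ag lev) (i : Fin n) :
    (1 - γ) * τ ≤ v i (part l ag lev i (Finset.range l)) := by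
  have hτp : 0 < τ ^ p := by positivity
  have hQ' : (0 : ℝ) < Q := by exact_mod_cast hQ
  have hη : 0 ≤ threshold m Q p τ := by unfold threshold; positivity
  have hmain := LocalOpt.sum_le (E := deficit v τ p) (δ := p ^ 2 * (1 / K) * τ ^ p) hl
    (fun i => isDeficit_shortfall_pow τ (hv i) p) hη hopt O hpin (by
      intro i J hJ
      refine le_sum_shortfall_pow_sub hτ.le (by positivity) (hv i) _ _ (hO i) hp ?_
      intro j hj
      refine hB i j hj _ fun x hx => ?_
      simp only [part, Finset.mem_filter, Finset.mem_univ, true_and]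
      exact ⟨(hBpin i x hx).1, Or.inl (hBpin i x hx).2⟩)
  set X := ∑ i, deficit v τ p i (part l ag lev i (Finset.range l)) with hX
  have h1 : ∑ i, deficit v τ p i (part l ag lev i ∅) ≤ n * τ ^ p := by
    have := Finset.sum_le_card_nsmul Finset.univ
      (fun i => deficit v τ p i (part l ag lev i ∅)) (τ ^ p) (fun i _ =>
        pow_le_pow_left₀ (shortfall_nonneg _ _ _) (shortfall_le hτ.le (hv i) _) p)
    simpa using this
  have h2 : (Fintype.card (Fin m) : ℝ) * l * threshold m Q p τ ≤ l / Q * τ ^ p := by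
    rw [Fintype.card_fin, threshold]
    have : (m : ℝ) * l * (τ ^ p / (Q * (m + 1))) = l / Q * τ ^ p * (m / (m + 1)) := by
      field_simp
    rw [this]
    refine mul_le_of_le_one_right (by positivity) ?_
    rw [div_le_one (by positivity)]
    linarith
  have h3 : (0 : ℝ) ≤ l ^ l * l.factorial := by positivity
  have h4 := mul_le_mul_of_nonneg_left h1 h3
  have h5 := mul_le_mul_of_nonneg_right hpar hτp.le
  have h6 : (0 : ℝ) < (l + p) ^ l * l.factorial := by positivity
  have h7 : (((l : ℝ) + p) ^ l * l.factorial) * X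
      ≤ (((l : ℝ) + p) ^ l * l.factorial) * (γ * τ) ^ p := by
    rw [mul_pow, hX]
    linarith
  have h8 : X ≤ (γ * τ) ^ p := le_of_mul_le_mul_left h7 h6
  have h9 : deficit v τ p i (part l ag lev i (Finset.range l)) ≤ X :=
    Finset.single_le_sum (f := fun i => deficit v τ p i (part l ag lev i (Finset.range l)))
      (fun i _ => pow_nonneg (shortfall_nonneg _ _ _) p) (Finset.mem_univ i)
  have h10 := (pow_le_pow_iff_left₀ (shortfall_nonneg _ _ _) (by positivity)
    (by omega : p ≠ 0)).1 (h9.trans h8)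
  have h11 := (le_max_left _ _).trans h10
  linarith

theorem opt_nonneg {v : Fin n → Finset (Fin m) → ℝ} (hv : ∀ i, IsValuation (v i)) : 0 ≤ opt v :=
  Real.iSup_nonneg fun _ => Real.iInf_nonneg fun i => (hv i).nonneg _

theorem exists_opt_allocation (hn : 1 ≤ n) (v : Fin n → Finset (Fin m) → ℝ) :
    ∃ O : Fin m → Fin n, (∀ i, opt v ≤ v i (bundle O i)) ∧ ∃ i, opt v = v i (bundle O i) := by
  have : Nonempty (Fin n) := ⟨⟨0, hn⟩⟩
  obtain ⟨O, hO⟩ := exists_eq_ciSup_of_finite (f := fun A : Fin m → Fin n => minValue v A)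
  obtain ⟨i, hi⟩ := exists_eq_ciInf_of_finite (f := fun i => v i (bundle O i))
  refine ⟨O, fun i => ?_, i, ?_⟩
  · rw [opt, ← hO]
    exact ciInf_le (Set.finite_range _).bddBelow i
  · rw [opt, ← hO, minValue, hi]

theorem IsValuation.le_sum_singleton {M : Type*} [DecidableEq M] {f : Finset M → ℝ}
    (hf : IsValuation f) (S : Finset M) : f S ≤ ∑ j ∈ S, f {j} := by
  induction S using Finset.induction_on with
  | empty => simp [hf.empty]
  | insert a S ha ih =>
    rw [Finset.sum_insert ha]
    have := hf.submodular ∅ S (Finset.empty_subset _) a ha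
    rw [hf.empty, insert_empty_eq] at this
    linarith

/-- One of the targets on the grid is slightly less than the optimum. -/
theorem exists_target {v : Fin n → Finset (Fin m) → ℝ} (hv : ∀ i, IsValuation (v i))
    (hn : 1 ≤ n) (hopt : 0 < opt v) {N : ℕ} (hN : 0 < N) :
    ∃ (i : Fin n) (j : Fin m) (r : ℕ), r < N * m + 1 ∧ 0 < v i {j} * r / N ∧
      v i {j} * r / N ≤ opt v ∧ (1 - 1 / N) * opt v ≤ v i {j} * r / N := by
  have hN' : (0 : ℝ) < N := by exact_mod_cast hN
  -- Let `w` be the largest singleton value in the bundle of an agent attaining the optimum. By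
  -- subadditivity `w ≤ opt v ≤ m * w`, so multiples of `w / N` have relative precision `1 / N`, and
  -- `N * m + 1` of them suffice.
  obtain ⟨O, -, i, hi⟩ := exists_opt_allocation hn v
  have hsum := (hv i).le_sum_singleton (bundle O i)
  rw [← hi] at hsum
  have hne : (bundle O i).Nonempty := by
    rw [Finset.nonempty_iff_ne_empty]
    intro h
    rw [h, Finset.sum_empty] at hsum
    linarith
  obtain ⟨j, hj, hmax⟩ := (bundle O i).exists_max_image (fun j => v i {j}) hne
  have h1 : opt v ≤ m * v i {j} := by
    refine hsum.trans ((Finset.sum_le_card_nsmul _ _ _ hmax).trans ?_)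
    rw [nsmul_eq_mul]
    refine mul_le_mul_of_nonneg_right ?_ ((hv i).nonneg _)
    have := Finset.card_le_univ (bundle O i)
    rw [Fintype.card_fin] at this
    exact_mod_cast this
  have h2 : v i {j} ≤ opt v := by
    rw [hi]; exact (hv i).mono _ _ (Finset.singleton_subset_iff.2 hj)
  have h3 : 0 < v i {j} := by
    rcases ((hv i).nonneg {j}).eq_or_lt with h | h
    · rw [← h, mul_zero] at h1; linarith
    · exact h
  set w := v i {j} with hw
  have hx0 : 0 ≤ opt v * N / w := by positivity
  have hr1 : (⌊opt v * N / w⌋₊ : ℝ) * w ≤ opt v * N := by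
    rw [← le_div_iff₀ h3]; exact Nat.floor_le hx0
  have hr2 : opt v * N < (⌊opt v * N / w⌋₊ + 1 : ℝ) * w := by
    rw [← div_lt_iff₀ h3]; exact Nat.lt_floor_add_one _
  have hr3 : N ≤ ⌊opt v * N / w⌋₊ := by
    refine Nat.le_floor ?_
    rw [le_div_iff₀ h3]
    nlinarith
  have hr4 : ⌊opt v * N / w⌋₊ ≤ N * m := by
    refine Nat.floor_le_of_le ?_
    push_cast
    rw [div_le_iff₀ h3]
    nlinarith
  generalize ⌊opt v * N / w⌋₊ = r at *
  have hr0 : (0 : ℝ) < r := by exact_mod_cast hN.trans_le hr3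
  refine ⟨i, j, r, by omega, by positivity, ?_, ?_⟩
  · rw [div_le_iff₀ hN']; linarith
  · rw [le_div_iff₀ hN']
    have : (1 - 1 / (N : ℝ)) * opt v * N = opt v * N - opt v := by field_simp
    rw [this]
    linarith

end Guarantee

/-! ## Execution of deterministic programs -/

section Machine

variable {n m : ℕ} (v : Fin n → Finset (Fin m) → ℝ)

/-- Within `t` steps the program `P` transforms the memory `μ` into `μ'`. -/
def Runs (P : Prog) (μ μ' : Mem) (t : ℕ) : Prop :=
  ∀ k, run v t ⟨P :: k, μ⟩ = PMF.pure ⟨k, μ'⟩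

theorem run_add (s t : ℕ) (c : Config) : run v (s + t) c = (run v s c).bind (run v t) := by
  induction s generalizing c with
  | zero => simp [run]
  | succ s ih =>
    rw [Nat.succ_add, run, run, PMF.bind_bind]
    congr 1
    funext c'
    exact ih c'

theorem run_halted (t : ℕ) (μ : Mem) : run v t ⟨[], μ⟩ = PMF.pure ⟨[], μ⟩ := by
  induction t with
  | zero => rfl
  | succ t ih => rw [run, step, PMF.pure_bind, ih]

theorem run_trans {s t : ℕ} {c c' : Config} (h : run v s c = PMF.pure c') :
    run v (s + t) c = run v t c' := by
  rw [run_add, h, PMF.pure_bind]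

/-- A bound on the number of steps of a program whose loops have at most `b` iterations. -/
def cost (b : ℕ) : Prog → ℕ
  | .seq c₁ c₂ => 1 + cost b c₁ + cost b c₂
  | .ite _ c₁ c₂ => 1 + cost b c₁ + cost b c₂
  | .loop _ c => b * (1 + cost b c) + 1
  | _ => 1

/-- Every loop contributes a factor of order `b`, and the degrees are added under composition; this
is crude, but the program is fixed. -/
theorem exists_cost_le (P : Prog) : ∃ C d : ℕ, ∀ b, cost b P ≤ C * (b + 1) ^ d := by
  have mono : ∀ C d d' b : ℕ, d ≤ d' → C * (b + 1) ^ d ≤ C * (b + 1) ^ d' := fun C d d' b h =>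
    Nat.mul_le_mul_left C (Nat.pow_le_pow_right (Nat.succ_pos b) h)
  have one : ∀ d b : ℕ, 1 ≤ (b + 1) ^ d := fun d b => Nat.one_le_pow _ _ (Nat.succ_pos b)
  have two : ∀ c₁ c₂ : Prog, (∃ C d : ℕ, ∀ b, cost b c₁ ≤ C * (b + 1) ^ d) →
      (∃ C d : ℕ, ∀ b, cost b c₂ ≤ C * (b + 1) ^ d) →
      ∃ C d : ℕ, ∀ b, 1 + cost b c₁ + cost b c₂ ≤ C * (b + 1) ^ d := by
    rintro c₁ c₂ ⟨C₁, d₁, h₁⟩ ⟨C₂, d₂, h₂⟩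
    refine ⟨1 + C₁ + C₂, d₁ + d₂, fun b => ?_⟩
    have e₁ := (h₁ b).trans (mono C₁ d₁ (d₁ + d₂) b (by omega))
    have e₂ := (h₂ b).trans (mono C₂ d₂ (d₁ + d₂) b (by omega))
    have e₃ := one (d₁ + d₂) b
    calc 1 + cost b c₁ + cost b c₂
        ≤ (b + 1) ^ (d₁ + d₂) + C₁ * (b + 1) ^ (d₁ + d₂) + C₂ * (b + 1) ^ (d₁ + d₂) := by omega
      _ = (1 + C₁ + C₂) * (b + 1) ^ (d₁ + d₂) := by ring
  induction P with
  | seq c₁ c₂ h₁ h₂ => exact two c₁ c₂ h₁ h₂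
  | ite _ c₁ c₂ h₁ h₂ => exact two c₁ c₂ h₁ h₂
  | loop _ c h =>
    obtain ⟨C, d, h⟩ := h
    refine ⟨2 + C, d + 1, fun b => ?_⟩
    have e₁ := one d b
    have e₂ : b * (1 + cost b c) ≤ b * ((1 + C) * (b + 1) ^ d) :=
      Nat.mul_le_mul_left b (by nlinarith [h b])
    have e₃ := one (d + 1) b
    calc cost b (.loop _ c) = b * (1 + cost b c) + 1 := rfl
      _ ≤ (b + 1) * ((1 + C) * (b + 1) ^ d) + (b + 1) ^ (d + 1) := by nlinarith
      _ = (2 + C) * (b + 1) ^ (d + 1) := by ring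
  | skip => exact ⟨1, 0, fun b => by simp [cost]⟩
  | setNat => exact ⟨1, 0, fun b => by simp [cost]⟩
  | setReal => exact ⟨1, 0, fun b => by simp [cost]⟩
  | query => exact ⟨1, 0, fun b => by simp [cost]⟩
  | rand => exact ⟨1, 0, fun b => by simp [cost]⟩

/-- Starting from the memory `μ`, the program `P` halts deterministically, with loops of at most
`b` iterations, in a memory with the property `Q`. -/
def WP (b : ℕ) (P : Prog) (Q : Mem → Prop) (μ : Mem) : Prop :=
  ∃ μ' t, t ≤ cost b P ∧ Runs v P μ μ' t ∧ Q μ'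

variable {v} {b : ℕ} {Q R : Mem → Prop} {μ : Mem}

theorem WP.mono {P : Prog} (h : WP v b P R μ) (hRQ : ∀ μ', R μ' → Q μ') : WP v b P Q μ := by
  obtain ⟨μ', t, h1, h2, h3⟩ := h
  exact ⟨μ', t, h1, h2, hRQ μ' h3⟩

theorem wp_skip (h : Q μ) : WP v b .skip Q μ :=
  ⟨μ, 1, le_rfl, fun k => by rw [run, step, PMF.pure_bind]; rfl, h⟩

theorem wp_setNat {a : ℕ} {i e : NExpr} (h : Q (μ.setNat a (i.eval μ) (e.eval μ))) :
    WP v b (.setNat a i e) Q μ :=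
  ⟨_, 1, le_rfl, fun k => by rw [run, step, PMF.pure_bind]; rfl, h⟩

theorem wp_setReal {a : ℕ} {i : NExpr} {e : RExpr}
    (h : Q (μ.setReal a (i.eval μ) (e.eval μ))) : WP v b (.setReal a i e) Q μ :=
  ⟨_, 1, le_rfl, fun k => by rw [run, step, PMF.pure_bind]; rfl, h⟩

theorem wp_query {a : ℕ} {i g : NExpr} {s : ℕ}
    (h : Q (μ.setReal a (i.eval μ) (oracle v μ (g.eval μ) s))) : WP v b (.query a i g s) Q μ :=
  ⟨_, 1, le_rfl, fun k => by rw [run, step, PMF.pure_bind]; rfl, h⟩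

theorem wp_seq {c₁ c₂ : Prog} (h : WP v b c₁ (WP v b c₂ Q) μ) : WP v b (.seq c₁ c₂) Q μ := by
  obtain ⟨μ₁, t₁, h1, h2, μ₂, t₂, h3, h4, h5⟩ := h
  refine ⟨μ₂, 1 + t₁ + t₂, by simp only [cost]; omega, fun k => ?_, h5⟩
  rw [run_trans (c' := ⟨c₂ :: k, μ₁⟩), h4 k]
  rw [run_trans (c' := ⟨c₁ :: c₂ :: k, μ⟩), h2]
  rw [run, step, PMF.pure_bind]; rfl

theorem wp_ite {B : Test} {c₁ c₂ : Prog} (h₁ : B.Holds μ → WP v b c₁ Q μ)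
    (h₂ : ¬ B.Holds μ → WP v b c₂ Q μ) : WP v b (.ite B c₁ c₂) Q μ := by
  by_cases hB : B.Holds μ
  · obtain ⟨μ', t, h1, h2, h3⟩ := h₁ hB
    refine ⟨μ', 1 + t, by simp only [cost]; omega, fun k => ?_, h3⟩
    rw [run_trans (c' := ⟨c₁ :: k, μ⟩), h2]
    rw [run, step, PMF.pure_bind, if_pos hB]; rfl
  · obtain ⟨μ', t, h1, h2, h3⟩ := h₂ hB
    refine ⟨μ', 1 + t, by simp only [cost]; omega, fun k => ?_, h3⟩
    rw [run_trans (c' := ⟨c₂ :: k, μ⟩), h2]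
    rw [run, step, PMF.pure_bind, if_neg hB]; rfl

/-- The invariant is indexed by the number of finished iterations and decides the test, so exactly
`N` iterations take place. -/
theorem wp_loop {B : Test} {c : Prog} {N : ℕ} (hN : N ≤ b) {I : ℕ → Mem → Prop} (h0 : I 0 μ)
    (hbody : ∀ k < N, ∀ μ, I k μ → B.Holds μ ∧ WP v b c (I (k + 1)) μ)
    (hend : ∀ μ, I N μ → ¬ B.Holds μ ∧ Q μ) : WP v b (.loop B c) Q μ := by
  have key : ∀ r k, k + r = N → ∀ μ, I k μ → ∃ μ' t, t ≤ r * (1 + cost b c) + 1 ∧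
      Runs v (.loop B c) μ μ' t ∧ Q μ' := by
    intro r
    induction r with
    | zero =>
      intro k hk μ hI
      obtain rfl : k = N := by omega
      obtain ⟨h1, h2⟩ := hend μ hI
      refine ⟨μ, 1, by omega, fun k => ?_, h2⟩
      rw [run, step, PMF.pure_bind, if_neg h1]; rfl
    | succ r ih =>
      intro k hk μ hI
      obtain ⟨h1, μ₁, t₁, h2, h3, h4⟩ := hbody k (by omega) μ hI
      obtain ⟨μ₂, t₂, h5, h6, h7⟩ := ih (k + 1) (by omega) μ₁ h4
      refine ⟨μ₂, 1 + t₁ + t₂, by rw [Nat.succ_mul]; omega, fun k => ?_, h7⟩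
      rw [run_trans (c' := ⟨.loop B c :: k, μ₁⟩), h6 k]
      rw [run_trans (c' := ⟨c :: .loop B c :: k, μ⟩), h3]
      rw [run, step, PMF.pure_bind, if_pos h1]; rfl
  obtain ⟨μ', t, h1, h2, h3⟩ := key N 0 (by omega) μ h0
  refine ⟨μ', t, h1.trans ?_, h2, h3⟩
  simp only [cost]
  gcongr

/-- Execute a list of programs one after the other. -/
def seqs (L : List Prog) : Prog := L.foldr .seq .skip

/-- The invariant depends on the part of the list already executed. This serves the sums over
agents, sets of levels and pins, which have constant size and are unrolled into the program text. -/
theorem wp_seqs_map {ι : Type*} {f : ι → Prog} (L : List ι) {I : List ι → Mem → Prop}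
    (h0 : I [] μ)
    (hbody : ∀ L₁ x L₂, L = L₁ ++ x :: L₂ → ∀ μ, I L₁ μ → WP v b (f x) (I (L₁ ++ [x])) μ)
    (hend : ∀ μ, I L μ → Q μ) : WP v b (seqs (L.map f)) Q μ := by
  have key : ∀ L₂ L₁, L = L₁ ++ L₂ → ∀ μ, I L₁ μ → WP v b (seqs (L₂.map f)) Q μ := by
    intro L₂
    induction L₂ with
    | nil =>
      intro L₁ hL μ hI
      rw [List.append_nil] at hL
      subst hL
      exact wp_skip (hend μ hI)
    | cons x L₂ ih =>
      intro L₁ hL μ hI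
      refine wp_seq ((hbody L₁ x L₂ hL μ hI).mono fun μ' h => ?_)
      exact ih (L₁ ++ [x]) (by simp [hL]) μ' h
  exact key L [] rfl μ h0

/-- The scalar variable stored in the array `x`. -/
def var (x : ℕ) : NExpr := .read x (.const 0)

/-- `for x = 0, …, e - 1 do c`. -/
def forLoop (x : ℕ) (e : NExpr) (c : Prog) : Prog :=
  .seq (.setNat x (.const 0) (.const 0))
    (.loop (.natLe (.add (var x) (.const 1)) e)
      (.seq c (.setNat x (.const 0) (.add (var x) (.const 1)))))

theorem wp_for {x : ℕ} {e : NExpr} {c : Prog} {N : ℕ} (hN : N ≤ b) {I : ℕ → Mem → Prop}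
    (h0 : I 0 (μ.setNat x 0 0))
    (hI : ∀ k μ, I k μ → μ.nat x 0 = k ∧ e.eval μ = N)
    (hbody : ∀ k < N, ∀ μ, I k μ →
      WP v b c (fun μ' => μ'.nat x 0 = k ∧ I (k + 1) (μ'.setNat x 0 (k + 1))) μ)
    (hend : ∀ μ, I N μ → Q μ) : WP v b (forLoop x e c) Q μ := by
  refine wp_seq (wp_setNat ?_)
  refine wp_loop hN (I := I) h0 ?_ ?_
  · intro k hk μ hμ
    refine ⟨?_, wp_seq ((hbody k hk μ hμ).mono fun μ' h => wp_setNat ?_)⟩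
    · simp only [Test.Holds, NExpr.eval, var, (hI k μ hμ).1, (hI k μ hμ).2]
      omega
    · simp only [NExpr.eval, var, h.1]
      exact h.2
  · intro μ hμ
    refine ⟨?_, hend μ hμ⟩
    simp only [Test.Holds, NExpr.eval, var, (hI N μ hμ).1, (hI N μ hμ).2]
    omega

/-- Nested loops; `L` lists the counters with their bounds. -/
def nest (L : List (ℕ × NExpr)) (c : Prog) : Prog :=
  L.foldr (fun y P => forLoop y.1 y.2 P) c

@[simp] theorem setNat_nat (μ : Mem) (a i x a' i' : ℕ) :
    (μ.setNat a i x).nat a' i' = if a' = a ∧ i' = i then x else μ.nat a' i' := by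
  simp only [Mem.setNat, Function.update_apply]
  split_ifs <;> simp_all

@[simp] theorem setNat_real (μ : Mem) (a i x : ℕ) : (μ.setNat a i x).real = μ.real := rfl

@[simp] theorem setReal_real (μ : Mem) (a i a' i' : ℕ) (x : ℝ) :
    (μ.setReal a i x).real a' i' = if a' = a ∧ i' = i then x else μ.real a' i' := by
  simp only [Mem.setReal, Function.update_apply]
  split_ifs <;> simp_all

@[simp] theorem setReal_nat (μ : Mem) (a i : ℕ) (x : ℝ) : (μ.setReal a i x).nat = μ.nat := rfl

/-- Nested loops preserve what their body preserves. -/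
theorem wp_nest (L : List (ℕ × NExpr)) {c : Prog} {bd : ℕ → ℕ} {I : Mem → Prop}
    (hL : (L.map Prod.fst).Nodup) (hbd : ∀ y ∈ L, bd y.1 ≤ b)
    (hset : ∀ y ∈ L, ∀ μ r, I μ → I (μ.setNat y.1 0 r))
    (heval : ∀ y ∈ L, ∀ μ, I μ → y.2.eval μ = bd y.1)
    (hbody : ∀ μ, I μ → (∀ y ∈ L, μ.nat y.1 0 < bd y.1) →
      WP v b c (fun μ' => I μ' ∧ ∀ y ∈ L, μ'.nat y.1 0 = μ.nat y.1 0) μ)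
    (hμ : I μ) : WP v b (nest L c) I μ := by
  induction L generalizing I μ with
  | nil => exact (hbody μ hμ (by simp)).mono fun μ' h => h.1
  | cons y L ih =>
    simp only [List.map_cons, List.nodup_cons, List.mem_map, not_exists, not_and] at hL
    have hne : ∀ z ∈ L, z.1 ≠ y.1 := fun z hz => hL.1 z hz
    refine wp_for (N := bd y.1) (I := fun k μ => I μ ∧ μ.nat y.1 0 = k) (hbd y (by simp))
      ⟨hset y (by simp) _ _ hμ, by simp⟩
      (fun k μ h => ⟨h.2, heval y (by simp) μ h.1⟩) ?_ (fun μ h => h.1)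
    intro k hk μ hμ
    refine (ih (I := fun μ => I μ ∧ μ.nat y.1 0 = k) hL.2 (fun z hz => hbd z (by simp [hz]))
      ?_ (fun z hz μ h => heval z (by simp [hz]) μ h.1) ?_ hμ).mono ?_
    · intro z hz μ r h
      exact ⟨hset z (by simp [hz]) μ r h.1, by simp [(hne z hz).symm, h.2]⟩
    · intro μ h hlt
      refine (hbody μ h.1 ?_).mono ?_
      · intro z hz
        rcases List.mem_cons.1 hz with rfl | hz
        · rw [h.2]; exact hk
        · exact hlt z hz
      · intro μ' h'
        exact ⟨⟨h'.1, (h'.2 y (by simp)).trans h.2⟩, fun z hz => h'.2 z (by simp [hz])⟩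
    · intro μ' h'
      exact ⟨h'.2, hset y (by simp) _ _ h'.1, by simp⟩

/-- Nested loops reach a goal that one of the iterations reaches and the others preserve. -/
theorem wp_nest_goal (L : List (ℕ × NExpr)) {c : Prog} {bd g : ℕ → ℕ} {I G : Mem → Prop}
    (hL : (L.map Prod.fst).Nodup) (hbd : ∀ y ∈ L, bd y.1 ≤ b) (hg : ∀ y ∈ L, g y.1 < bd y.1)
    (hset : ∀ y ∈ L, ∀ μ r, I μ → I (μ.setNat y.1 0 r))
    (hsetG : ∀ y ∈ L, ∀ μ r, G μ → G (μ.setNat y.1 0 r))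
    (heval : ∀ y ∈ L, ∀ μ, I μ → y.2.eval μ = bd y.1)
    (hbody : ∀ μ, I μ → (∀ y ∈ L, μ.nat y.1 0 < bd y.1) →
      WP v b c (fun μ' => I μ' ∧ (∀ y ∈ L, μ'.nat y.1 0 = μ.nat y.1 0) ∧
        (G μ ∨ (∀ y ∈ L, μ.nat y.1 0 = g y.1) → G μ')) μ)
    (hμ : I μ) : WP v b (nest L c) (fun μ => I μ ∧ G μ) μ := by
  induction L generalizing I μ with
  | nil => exact (hbody μ hμ (by simp)).mono fun μ' h => ⟨h.1, h.2.2 (Or.inr (by simp))⟩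
  | cons y L ih =>
    simp only [List.map_cons, List.nodup_cons, List.mem_map, not_exists, not_and] at hL
    have hne : ∀ z ∈ L, z.1 ≠ y.1 := fun z hz => hL.1 z hz
    have hgy := hg y (by simp)
    refine wp_for (N := bd y.1)
      (I := fun k μ => I μ ∧ μ.nat y.1 0 = k ∧ (g y.1 < k → G μ)) (hbd y (by simp))
      ⟨hset y (by simp) _ _ hμ, by simp, by simp⟩
      (fun k μ h => ⟨h.2.1, heval y (by simp) μ h.1⟩) ?_ (fun μ h => ⟨h.1, h.2.2 hgy⟩)
    intro k hk μ hμ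
    have hstep : ∀ μ, I μ → μ.nat y.1 0 = k → (∀ z ∈ L, μ.nat z.1 0 < bd z.1) →
        ∀ z ∈ y :: L, μ.nat z.1 0 < bd z.1 := by
      intro μ h h' hlt z hz
      rcases List.mem_cons.1 hz with rfl | hz
      · rw [h']; exact hk
      · exact hlt z hz
    have hset' : ∀ z ∈ L, ∀ (μ : Mem) r, I μ ∧ μ.nat y.1 0 = k →
        I (μ.setNat z.1 0 r) ∧ (μ.setNat z.1 0 r).nat y.1 0 = k := fun z hz μ r h =>
      ⟨hset z (by simp [hz]) μ r h.1, by simp [(hne z hz).symm, h.2]⟩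
    -- Before the goal's value of the outer counter nothing is claimed about `G`; at this value the
    -- inner loops reach `G` by induction; afterwards `G` is part of the invariant.
    rcases lt_trichotomy k (g y.1) with hkg | hkg | hkg
    · refine (wp_nest (bd := bd) L (I := fun μ => I μ ∧ μ.nat y.1 0 = k) hL.2
        (fun z hz => hbd z (by simp [hz])) hset'
        (fun z hz μ h => heval z (by simp [hz]) μ h.1) ?_ ⟨hμ.1, hμ.2.1⟩).mono ?_
      · intro μ h hlt
        refine (hbody μ h.1 (hstep μ h.1 h.2 hlt)).mono fun μ' h' => ?_
        exact ⟨⟨h'.1, (h'.2.1 y (by simp)).trans h.2⟩, fun z hz => h'.2.1 z (by simp [hz])⟩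
      · intro μ' h'
        exact ⟨h'.2, hset y (by simp) _ _ h'.1, by simp, fun h => by omega⟩
    · refine (ih (I := fun μ => I μ ∧ μ.nat y.1 0 = k) hL.2 (fun z hz => hbd z (by simp [hz]))
        (fun z hz => hg z (by simp [hz])) hset' (fun z hz => hsetG z (by simp [hz]))
        (fun z hz μ h => heval z (by simp [hz]) μ h.1) ?_ ⟨hμ.1, hμ.2.1⟩).mono ?_
      · intro μ h hlt
        refine (hbody μ h.1 (hstep μ h.1 h.2 hlt)).mono fun μ' h' => ?_
        refine ⟨⟨h'.1, (h'.2.1 y (by simp)).trans h.2⟩, fun z hz => h'.2.1 z (by simp [hz]),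
          fun hG => h'.2.2 (hG.imp_right fun hall z hz => ?_)⟩
        rcases List.mem_cons.1 hz with rfl | hz
        · rw [h.2, hkg]
        · exact hall z hz
      · intro μ' h'
        exact ⟨h'.1.2, hset y (by simp) _ _ h'.1.1, by simp, fun _ => hsetG y (by simp) _ _ h'.2⟩
    · refine (wp_nest (bd := bd) L (I := fun μ => (I μ ∧ μ.nat y.1 0 = k) ∧ G μ) hL.2
        (fun z hz => hbd z (by simp [hz]))
        (fun z hz μ r h => ⟨hset' z hz μ r h.1, hsetG z (by simp [hz]) μ r h.2⟩)
        (fun z hz μ h => heval z (by simp [hz]) μ h.1.1) ?_ ⟨⟨hμ.1, hμ.2.1⟩, hμ.2.2 hkg⟩).mono ?_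
      · intro μ h hlt
        refine (hbody μ h.1.1 (hstep μ h.1.1 h.1.2 hlt)).mono fun μ' h' => ?_
        exact ⟨⟨⟨h'.1, (h'.2.1 y (by simp)).trans h.1.2⟩, h'.2.2 (Or.inl h.2)⟩,
          fun z hz => h'.2.1 z (by simp [hz])⟩
      · intro μ' h'
        exact ⟨h'.1.2, hset y (by simp) _ _ h'.1.1, by simp, fun _ => hsetG y (by simp) _ _ h'.2⟩

/-- A program that halts deterministically in time. -/
theorem WP.run_eq {P : Prog} (h : WP v b P Q μ) {T : ℕ} (hT : cost b P ≤ T) :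
    ∃ μ', run v T ⟨[P], μ⟩ = PMF.pure ⟨[], μ'⟩ ∧ Q μ' := by
  obtain ⟨μ', t, h1, h2, h3⟩ := h
  refine ⟨μ', ?_, h3⟩
  obtain ⟨s, rfl⟩ := Nat.exists_eq_add_of_le (h1.trans hT)
  rw [run_trans v (h2 []), run_halted]

end Machine

/-! ## The program

The natural-number arrays `2` and `3` hold the agents and the levels of the items, `4` the
indicator of the set to be queried, `5` to `9` and `12` to `14` loop counters, and `20 + s` the item
of pin number `s`. The real variables `0` to `5` are the target, the potential that is being
computed, the last answer of the oracle, the potential of the current state, the best value and the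
value of the current candidate. -/

/-- The real variable stored in the array `x`. -/
def rvar (x : ℕ) : RExpr := .read x (.const 0)

/-- Multiplication by a constant. -/
def NExpr.nsmul (e : NExpr) : ℕ → NExpr
  | 0 => .const 0
  | k + 1 => .add (e.nsmul k) e

@[simp] theorem NExpr.eval_nsmul (μ : Mem) (e : NExpr) (k : ℕ) :
    (e.nsmul k).eval μ = k * e.eval μ := by
  induction k with
  | zero => simp [nsmul, eval]
  | succ k ih => simp only [nsmul, eval, ih]; ring

/-- Power with a constant exponent. -/
def RExpr.npow (e : RExpr) : ℕ → RExpr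
  | 0 => .cast (.const 1)
  | k + 1 => .mul (e.npow k) e

@[simp] theorem RExpr.eval_npow (μ : Mem) (e : RExpr) (k : ℕ) :
    (e.npow k).eval μ = e.eval μ ^ k := by
  induction k with
  | zero => simp [npow, eval, NExpr.eval]
  | succ k ih => simp only [npow, eval, ih]; ring

@[simp] theorem NExpr.eval_var (μ : Mem) (x : ℕ) : (var x).eval μ = μ.nat x 0 := rfl

@[simp] theorem RExpr.eval_rvar (μ : Mem) (x : ℕ) : (rvar x).eval μ = μ.real x 0 := rfl

/-- Equality of natural numbers. -/
def Test.eq (e₁ e₂ : NExpr) : Test := .conj (.natLe e₁ e₂) (.natLe e₂ e₁)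

@[simp] theorem Test.holds_eq (μ : Mem) (e₁ e₂ : NExpr) :
    (Test.eq e₁ e₂).Holds μ ↔ e₁.eval μ = e₂.eval μ := by
  simp only [Test.eq, Test.Holds]; omega

/-- Disjunction. -/
def Test.or (b₁ b₂ : Test) : Test := .neg (.conj (.neg b₁) (.neg b₂))

@[simp] theorem Test.holds_or (μ : Mem) (b₁ b₂ : Test) :
    (Test.or b₁ b₂).Holds μ ↔ b₁.Holds μ ∨ b₂.Holds μ := by
  simp only [Test.or, Test.Holds]; tauto

/-- Membership in a list of constants. -/
def Test.mem (e : NExpr) (L : List ℕ) : Test :=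
  L.foldr (fun k b => Test.or (.eq e (.const k)) b) (.natLe (.const 1) (.const 0))

@[simp] theorem Test.holds_mem (μ : Mem) (e : NExpr) (L : List ℕ) :
    (Test.mem e L).Holds μ ↔ e.eval μ ∈ L := by
  induction L with
  | nil => simp [Test.mem, Test.Holds, NExpr.eval]
  | cons k L ih =>
    have : Test.mem e (k :: L) = Test.or (.eq e (.const k)) (Test.mem e L) := rfl
    rw [this, Test.holds_or, ih, Test.holds_eq, List.mem_cons]
    rfl

/-! ### Frame conditions. -/

/-- The memories agree outside the arrays in the lists. -/
structure Frame (X Y : List ℕ) (μ μ' : Mem) : Prop where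
  nat : ∀ a, a ∉ X → μ'.nat a = μ.nat a
  real : ∀ a, a ∉ Y → μ'.real a = μ.real a

theorem Frame.refl (X Y : List ℕ) (μ : Mem) : Frame X Y μ μ := ⟨fun _ _ => rfl, fun _ _ => rfl⟩

theorem Frame.trans {X Y X' Y' X'' Y'' : List ℕ} {μ μ' μ'' : Mem} (h : Frame X Y μ μ')
    (h' : Frame X' Y' μ' μ'') (hX : X ⊆ X'') (hX' : X' ⊆ X'') (hY : Y ⊆ Y'') (hY' : Y' ⊆ Y'') :
    Frame X'' Y'' μ μ'' :=
  ⟨fun a ha => (h'.nat a fun h => ha (hX' h)).trans (h.nat a fun h => ha (hX h)),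
    fun a ha => (h'.real a fun h => ha (hY' h)).trans (h.real a fun h => ha (hY h))⟩

theorem Frame.setNat {X Y : List ℕ} {μ μ' : Mem} (h : Frame X Y μ μ') {a : ℕ} (ha : a ∈ X)
    (i x : ℕ) : Frame X Y μ (μ'.setNat a i x) :=
  ⟨fun a' ha' => by
    rw [← h.nat a' ha']
    funext i'
    rw [setNat_nat, if_neg]
    rintro ⟨rfl, -⟩
    exact ha' ha, h.real⟩

theorem Frame.setReal {X Y : List ℕ} {μ μ' : Mem} (h : Frame X Y μ μ') {a : ℕ} (ha : a ∈ Y)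
    (i : ℕ) (x : ℝ) : Frame X Y μ (μ'.setReal a i x) :=
  ⟨h.nat, fun a' ha' => by
    rw [← h.real a' ha']
    funext i'
    rw [setReal_real, if_neg]
    rintro ⟨rfl, -⟩
    exact ha' ha⟩

/-! ### Set queries, evaluation of the potential and a single move. -/

section Program

variable {n m : ℕ} {v : Fin n → Finset (Fin m) → ℝ} {b : ℕ} {μ : Mem}

/-- The agents of the items. -/
def agOf (m : ℕ) (μ : Mem) : Fin m → ℕ := fun j => μ.nat 2 j

/-- The levels of the items. -/
def levOf (m : ℕ) (μ : Mem) : Fin m → ℕ := fun j => μ.nat 3 j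

theorem Frame.agOf_eq {X Y : List ℕ} {μ μ' : Mem} (h : Frame X Y μ μ') (hX : 2 ∉ X) :
    agOf m μ' = agOf m μ := by
  unfold agOf; rw [h.nat 2 hX]

theorem Frame.levOf_eq {X Y : List ℕ} {μ μ' : Mem} (h : Frame X Y μ μ') (hX : 3 ∉ X) :
    levOf m μ' = levOf m μ := by
  unfold levOf; rw [h.nat 3 hX]

/-- Ask agent `g` for the value of the set of all items `5` with the property `B`. -/
def querySet (B : Test) (g : NExpr) : Prog :=
  .seq (forLoop 5 (var 0) (.ite B (.setNat 4 (var 5) (.const 1)) (.setNat 4 (var 5) (.const 0))))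
    (.query 2 (.const 0) g 4)

/-- The hypotheses range over all memories that differ from `μ` in the arrays `4` and `5` only,
because `B` is evaluated while the indicator is being written and `g` afterwards. -/
theorem wp_querySet {B : Test} {g : NExpr} (hm : μ.nat 0 0 = m) (hb : m ≤ b) {i : Fin n}
    {S : Finset (Fin m)} (hg : ∀ μ', Frame [4, 5] [] μ μ' → g.eval μ' = i)
    (hB : ∀ μ', Frame [4, 5] [] μ μ' → ∀ j : Fin m, μ'.nat 5 0 = j → (B.Holds μ' ↔ j ∈ S)) :
    WP v b (querySet B g) (fun μ' => Frame [4, 5] [2] μ μ' ∧ μ'.real 2 0 = v i S) μ := by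
  refine wp_seq (wp_for (N := m) (I := fun k μ' => Frame [4, 5] [] μ μ' ∧ μ'.nat 5 0 = k ∧
    ∀ j : Fin m, j < k → (μ'.nat 4 j ≠ 0 ↔ j ∈ S)) hb ?_ ?_ ?_ ?_)
  · exact ⟨(Frame.refl _ _ μ).setNat (by decide) _ _, by simp, fun j hj => by omega⟩
  · rintro k μ' ⟨h1, h2, -⟩
    refine ⟨h2, ?_⟩
    rw [NExpr.eval_var, h1.nat 0 (by decide), hm]
  · rintro k hk μ' ⟨h1, h2, h3⟩
    have hBk := hB μ' h1 ⟨k, hk⟩ h2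
    have key : ∀ x : ℕ, (x ≠ 0 ↔ (⟨k, hk⟩ : Fin m) ∈ S) → WP v b (.setNat 4 (var 5) (.const x))
        (fun μ' => μ'.nat 5 0 = k ∧ Frame [4, 5] [] μ (μ'.setNat 5 0 (k + 1)) ∧
          (μ'.setNat 5 0 (k + 1)).nat 5 0 = k + 1 ∧
          ∀ j : Fin m, j < k + 1 → ((μ'.setNat 5 0 (k + 1)).nat 4 j ≠ 0 ↔ j ∈ S)) μ' := by
      intro x hx
      refine wp_setNat ⟨by simp [h2], (h1.setNat (by decide) _ _).setNat (by decide) _ _,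
        by simp, fun j hj => ?_⟩
      rcases Nat.lt_succ_iff_lt_or_eq.1 hj with hj | hj
      · simpa [h2, hj.ne, NExpr.eval] using h3 j hj
      · obtain rfl : j = ⟨k, hk⟩ := Fin.ext hj
        simpa [h2, NExpr.eval] using hx
    exact wp_ite (fun h => key 1 (by simp [hBk.1 h])) (fun h => key 0 (by simp [mt hBk.2 h]))
  · rintro μ' ⟨h1, -, h3⟩
    refine wp_query ⟨?_, ?_⟩
    · exact (h1.trans (Frame.refl [4, 5] [2] μ') (by simp) (by simp) (by simp) (by simp)).setReal
        (by simp) _ _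
    · rw [hg μ' h1]
      simp only [NExpr.eval, setReal_real, oracle, i.2, dif_pos, and_self, if_true]
      congr 1
      ext j
      simpa using h3 j j.2

/-- Item `5` belongs to the agent `i` and is pinned or has a level in `J`. -/
noncomputable def partTest (l i : ℕ) (J : Finset ℕ) : Test :=
  .conj (.eq (.read 2 (var 5)) (.const i))
    (.or (.natLe (.const l) (.read 3 (var 5))) (.mem (.read 3 (var 5)) J.toList))

theorem wp_queryPart (hm : μ.nat 0 0 = m) (hb : m ≤ b) (l : ℕ) (i : Fin n) (J : Finset ℕ) :
    WP v b (querySet (partTest l i J) (.const i)) (fun μ' => Frame [4, 5] [2] μ μ' ∧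
      μ'.real 2 0 = v i (part l (agOf m μ) (levOf m μ) i J)) μ := by
  refine wp_querySet hm hb (fun _ _ => rfl) fun μ' h j hj => ?_
  rw [part, Finset.mem_filter]
  simp [partTest, Test.Holds, NExpr.eval, hj, h.nat 2, h.nat 3, agOf, levOf]

/-- The summand of the potential for the agent `x.1` and the set of levels `x.2`. -/
noncomputable def potentialTerm (l p : ℕ) (x : Fin n × Finset ℕ) : Prog :=
  .seq (querySet (partTest l x.1 x.2) (.const x.1))
    (.ite (.realLe (rvar 2) (rvar 0))
      (.setReal 1 (.const 0) (.add (rvar 1) (.mul (.cast (.const (levelWeight l p x.2.card)))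
        ((RExpr.sub (rvar 0) (rvar 2)).npow p)))) .skip)

/-- Compute the potential. -/
noncomputable def computePotential (n l p : ℕ) : Prog :=
  .seq (.setReal 1 (.const 0) (.cast (.const 0)))
    (seqs (((Finset.univ : Finset (Fin n)) ×ˢ (Finset.range l).powerset).toList.map
      (potentialTerm l p)))

theorem wp_computePotential (hm : μ.nat 0 0 = m) (hb : m ≤ b) (l : ℕ) {p : ℕ} (hp : 1 ≤ p) :
    WP v b (computePotential n l p) (fun μ' => Frame [4, 5] [1, 2] μ μ' ∧
      μ'.real 1 0 = potential l p (deficit v (μ.real 0 0) p) (agOf m μ) (levOf m μ)) μ := by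
  set t : Fin n × Finset ℕ → ℝ := fun x => (levelWeight l p x.2.card : ℝ) *
    deficit v (μ.real 0 0) p x.1 (part l (agOf m μ) (levOf m μ) x.1 x.2) with ht
  refine wp_seq (wp_setReal (wp_seqs_map _ (I := fun L μ' => Frame [4, 5] [1, 2] μ μ' ∧
    μ'.real 1 0 = (L.map t).sum) ?_ ?_ ?_))
  · exact ⟨(Frame.refl _ _ μ).setReal (by decide) _ _, by simp [RExpr.eval, NExpr.eval]⟩
  · rintro L₁ x L₂ - μ₁ ⟨h1, h2⟩
    have hm₁ : μ₁.nat 0 0 = m := by rw [h1.nat 0 (by decide), hm]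
    refine wp_seq ((wp_queryPart hm₁ hb l x.1 x.2).mono ?_)
    rintro μ₂ ⟨h3, h4⟩
    have h5 : Frame [4, 5] [1, 2] μ μ₂ := h1.trans h3 (by simp) (by simp) (by simp) (by simp)
    rw [h1.agOf_eq (by decide), h1.levOf_eq (by decide)] at h4
    have h6 : μ₂.real 0 0 = μ.real 0 0 := by rw [h5.real 0 (by decide)]
    have h7 : μ₂.real 1 0 = (L₁.map t).sum := by rw [h3.real 1 (by decide), h2]
    refine wp_ite (fun h => wp_setReal ⟨h5.setReal (by decide) _ _, ?_⟩)
      (fun h => wp_skip ⟨h5, ?_⟩)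
    · simp only [Test.Holds, RExpr.eval_rvar, h4, h6] at h
      simp [RExpr.eval, NExpr.eval, h7, h4, h6, ht, deficit, shortfall, h]
    -- Above the target the shortfall is zero, and `0 ^ p = 0` because `1 ≤ p`, so skipping the
    -- summand is correct.
    · simp only [Test.Holds, RExpr.eval_rvar, h4, h6, not_le] at h
      simp only [h7, ht, deficit, shortfall, List.map_append, List.map_cons, List.map_nil,
        List.sum_append, List.sum_cons, List.sum_nil]
      rw [max_eq_right (by linarith), zero_pow (by omega)]
      simp
  · rintro μ' ⟨h1, h2⟩
    refine ⟨h1, ?_⟩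
    rw [h2, Finset.sum_map_toList, Finset.sum_product]
    rfl

/-- The threshold for moving an item. -/
def thresholdExpr (Q p : ℕ) : RExpr :=
  .div ((rvar 0).npow p) (.mul (.cast (.const Q)) (.cast (.add (var 0) (.const 1))))

theorem eval_thresholdExpr (hm : μ.nat 0 0 = m) (Q p : ℕ) :
    (thresholdExpr Q p).eval μ = threshold m Q p (μ.real 0 0) := by
  simp [thresholdExpr, threshold, RExpr.eval, NExpr.eval, hm]

/-- Move item `6` to agent `7` at level `8` if this decreases the potential sufficiently. -/
noncomputable def tryMove (n l p Q : ℕ) : Prog :=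
  .ite (.natLe (.const l) (.read 3 (var 6))) .skip <|
    .seq (.setNat 10 (.const 0) (.read 2 (var 6))) <|
    .seq (.setNat 11 (.const 0) (.read 3 (var 6))) <|
    .seq (.setNat 2 (var 6) (var 7)) <|
    .seq (.setNat 3 (var 6) (var 8)) <|
    .seq (computePotential n l p) <|
    .ite (.realLe (.add (rvar 1) (thresholdExpr Q p)) (rvar 3))
      (.setReal 3 (.const 0) (rvar 1))
      (.seq (.setNat 2 (var 6) (var 10)) (.setNat 3 (var 6) (var 11)))

/-- The potential of the state in the memory. -/
noncomputable def memPotential (v : Fin n → Finset (Fin m) → ℝ) (l p : ℕ) (μ : Mem) : ℝ :=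
  potential l p (deficit v (μ.real 0 0) p) (agOf m μ) (levOf m μ)

/-- The potential after a move. -/
noncomputable def movePotential (v : Fin n → Finset (Fin m) → ℝ) (l p : ℕ) (μ : Mem) (j : Fin m)
    (i k : ℕ) : ℝ :=
  potential l p (deficit v (μ.real 0 0) p) (Function.update (agOf m μ) j i)
    (Function.update (levOf m μ) j k)

theorem agOf_setNat (μ : Mem) (j : Fin m) (x : ℕ) :
    agOf m (μ.setNat 2 j x) = Function.update (agOf m μ) j x := by
  funext j'
  simp [agOf, Function.update_apply, Fin.val_inj]

theorem levOf_setNat (μ : Mem) (j : Fin m) (x : ℕ) :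
    levOf m (μ.setNat 3 j x) = Function.update (levOf m μ) j x := by
  funext j'
  simp [levOf, Function.update_apply, Fin.val_inj]

theorem agOf_setNat_of_ne (μ : Mem) {a : ℕ} (ha : 2 ≠ a) (i x : ℕ) :
    agOf m (μ.setNat a i x) = agOf m μ := by
  funext j'
  simp [agOf, ha]

theorem levOf_setNat_of_ne (μ : Mem) {a : ℕ} (ha : 3 ≠ a) (i x : ℕ) :
    levOf m (μ.setNat a i x) = levOf m μ := by
  funext j'
  simp [levOf, ha]

/-- A candidate is compared with the potential recorded in the real variable `3`, so the correctness
of this record is both required and reestablished, also when the move is undone. -/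
theorem wp_tryMove (hm : μ.nat 0 0 = m) (hb : m ≤ b) {l p Q : ℕ} (hp : 1 ≤ p)
    (hcur : μ.real 3 0 = memPotential v l p μ) {j : Fin m} (hj : μ.nat 6 0 = j) {i k : ℕ}
    (hi : μ.nat 7 0 = i) (hk : μ.nat 8 0 = k) :
    WP v b (tryMove n l p Q) (fun μ' => Frame [2, 3, 4, 5, 10, 11] [1, 2, 3] μ μ' ∧
      μ'.real 3 0 = memPotential v l p μ' ∧
      if levOf m μ j < l ∧
          movePotential v l p μ j i k + threshold m Q p (μ.real 0 0) ≤ memPotential v l p μ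
        then agOf m μ' = Function.update (agOf m μ) j i ∧
          levOf m μ' = Function.update (levOf m μ) j k
        else agOf m μ' = agOf m μ ∧ levOf m μ' = levOf m μ) μ := by
  have hlev : μ.nat 3 (μ.nat 6 0) = levOf m μ j := by rw [hj]; rfl
  refine wp_ite (fun h => wp_skip ⟨Frame.refl _ _ _, hcur, ?_⟩) (fun h => ?_)
  · simp only [Test.Holds, NExpr.eval, NExpr.eval_var, hlev] at h
    rw [if_neg (by omega)]
    exact ⟨rfl, rfl⟩
  simp only [Test.Holds, NExpr.eval, NExpr.eval_var, hlev, not_le] at h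
  refine wp_seq (wp_setNat (wp_seq (wp_setNat (wp_seq (wp_setNat (wp_seq (wp_setNat ?_)))))))
  simp only [NExpr.eval, NExpr.eval_var, setNat_nat, hj, hi, hk, Nat.reduceEqDiff, false_and,
    if_false]
  set μ₁ := (((μ.setNat 10 0 (μ.nat 2 j)).setNat 11 0 (μ.nat 3 j)).setNat 2 j i).setNat 3 j k
    with hμ₁
  have f₁ : Frame [2, 3, 4, 5, 10, 11] [1, 2, 3] μ μ₁ :=
    ((((Frame.refl _ _ μ).setNat (by decide) _ _).setNat (by decide) _ _).setNat
      (by decide) _ _).setNat (by decide) _ _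
  have ag₁ : agOf m μ₁ = Function.update (agOf m μ) j i := by
    rw [hμ₁, agOf_setNat_of_ne _ (by decide), agOf_setNat, agOf_setNat_of_ne _ (by decide),
      agOf_setNat_of_ne _ (by decide)]
  have lev₁ : levOf m μ₁ = Function.update (levOf m μ) j k := by
    rw [hμ₁, levOf_setNat, levOf_setNat_of_ne _ (by decide), levOf_setNat_of_ne _ (by decide),
      levOf_setNat_of_ne _ (by decide)]
  have s₁ : μ₁.nat 10 0 = agOf m μ j ∧ μ₁.nat 11 0 = levOf m μ j := by
    simp [hμ₁, agOf, levOf]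
  have hm₁ : μ₁.nat 0 0 = m := by rw [f₁.nat 0 (by decide), hm]
  refine wp_seq ((wp_computePotential hm₁ hb l hp).mono ?_)
  rintro μ₂ ⟨f₂, h₂⟩
  have f₃ : Frame [2, 3, 4, 5, 10, 11] [1, 2, 3] μ μ₂ :=
    f₁.trans f₂ (by simp) (by simp) (by simp) (by simp)
  have hm₂ : μ₂.nat 0 0 = m := by rw [f₃.nat 0 (by decide), hm]
  have τ₂ : μ₂.real 0 0 = μ.real 0 0 := by rw [f₃.real 0 (by decide)]
  have cur₂ : μ₂.real 3 0 = memPotential v l p μ := by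
    rw [f₂.real 3 (by decide)]
    exact hcur
  have ag₂ := f₂.agOf_eq (m := m) (by decide)
  have lev₂ := f₂.levOf_eq (m := m) (by decide)
  rw [ag₁] at ag₂
  rw [lev₁] at lev₂
  rw [ag₁, lev₁, f₁.real 0 (by decide)] at h₂
  have h₂' : μ₂.real 1 0 = movePotential v l p μ j i k := h₂
  refine wp_ite (fun h' => wp_setReal ⟨f₃.setReal (by decide) _ _, ?_, ?_⟩) (fun h' => ?_)
  · have : memPotential v l p (μ₂.setReal 3 0 (μ₂.real 1 0)) = memPotential v l p μ₂ := rfl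
    simp only [NExpr.eval, RExpr.eval_rvar]
    rw [this, memPotential, ag₂, lev₂, τ₂]
    simpa using h₂
  · simp only [Test.Holds, RExpr.eval, RExpr.eval_rvar, eval_thresholdExpr hm₂, h₂', τ₂, cur₂]
      at h'
    rw [if_pos ⟨h, h'⟩]
    exact ⟨ag₂, lev₂⟩
  · simp only [Test.Holds, RExpr.eval, RExpr.eval_rvar, eval_thresholdExpr hm₂, h₂', τ₂, cur₂]
      at h'
    refine wp_seq (wp_setNat (wp_setNat ?_))
    have j₂ : μ₂.nat 6 0 = j := by rw [f₃.nat 6 (by decide), hj]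
    have s₂ : μ₂.nat 10 0 = agOf m μ j ∧ μ₂.nat 11 0 = levOf m μ j := by
      rw [f₂.nat 10 (by decide), f₂.nat 11 (by decide)]; exact s₁
    simp only [NExpr.eval_var, setNat_nat, j₂, s₂, Nat.reduceEqDiff, false_and, if_false]
    rw [if_neg fun h'' => h' h''.2]
    have agf : agOf m ((μ₂.setNat 2 j (agOf m μ j)).setNat 3 j (levOf m μ j)) = agOf m μ := by
      rw [agOf_setNat_of_ne _ (by decide), agOf_setNat, ag₂]
      simp
    have levf : levOf m ((μ₂.setNat 2 j (agOf m μ j)).setNat 3 j (levOf m μ j)) = levOf m μ := by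
      rw [levOf_setNat, levOf_setNat_of_ne _ (by decide), lev₂]
      simp
    refine ⟨(f₃.setNat (by decide) _ _).setNat (by decide) _ _, ?_, agf, levf⟩
    rw [memPotential, agf, levf]
    simp only [setNat_real]
    rw [cur₂, τ₂]
    rfl

end Program

/-! ### Sweeps and their number. -/

section Search

variable {n m : ℕ} {v : Fin n → Finset (Fin m) → ℝ} {b : ℕ} {μ : Mem}

/-- The state `ag, lev` arises from `ag₀, lev₀` by moving items that are not pinned. -/
def Reach (n l : ℕ) (ag₀ lev₀ ag lev : Fin m → ℕ) : Prop :=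
  ∀ j, ag j < n ∧ (l ≤ lev j ↔ l ≤ lev₀ j) ∧ (l ≤ lev₀ j → ag j = ag₀ j)

theorem Reach.update {l : ℕ} {ag₀ lev₀ ag lev : Fin m → ℕ} (h : Reach n l ag₀ lev₀ ag lev)
    {j : Fin m} (hj : lev j < l) {i k : ℕ} (hi : i < n) (hk : k < l) :
    Reach n l ag₀ lev₀ (Function.update ag j i) (Function.update lev j k) := by
  intro j'
  by_cases hjj : j' = j
  · subst hjj
    have := (h j').2.1
    simp only [Function.update_self]
    exact ⟨hi, by omega, by omega⟩
  · simpa [hjj] using h j'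

/-- Try all moves. -/
noncomputable def sweep (n l p Q : ℕ) : Prog :=
  nest [(6, var 0), (7, .const n), (8, .const l)] (tryMove n l p Q)

/-- The memory during the local search. -/
structure Searching (v : Fin n → Finset (Fin m) → ℝ) (l p : ℕ) (ag₀ lev₀ : Fin m → ℕ)
    (μ₀ μ : Mem) : Prop where
  frame : Frame [2, 3, 4, 5, 6, 7, 8, 9, 10, 11] [1, 2, 3] μ₀ μ
  items : μ.nat 0 0 = m
  reach : Reach n l ag₀ lev₀ (agOf m μ) (levOf m μ)
  cur : μ.real 3 0 = memPotential v l p μ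

theorem Searching.setNat {l p : ℕ} {ag₀ lev₀ : Fin m → ℕ} {μ₀ : Mem}
    (h : Searching v l p ag₀ lev₀ μ₀ μ) {x : ℕ} (hx : x ∈ [6, 7, 8, 9]) (r : ℕ) :
    Searching v l p ag₀ lev₀ μ₀ (μ.setNat x 0 r) := by
  have hne : 2 ≠ x ∧ 3 ≠ x ∧ 0 ≠ x ∧ x ∈ [2, 3, 4, 5, 6, 7, 8, 9, 10, 11] := by
    simp only [List.mem_cons, List.not_mem_nil, or_false] at hx
    rcases hx with rfl | rfl | rfl | rfl <;> decide
  refine ⟨h.frame.setNat hne.2.2.2 _ _, by simp [hne.2.2.1, h.items], ?_, ?_⟩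
  · rw [agOf_setNat_of_ne _ hne.1, levOf_setNat_of_ne _ hne.2.1]; exact h.reach
  · rw [memPotential, agOf_setNat_of_ne _ hne.1, levOf_setNat_of_ne _ hne.2.1]; exact h.cur

/-- No move decreases the potential of the state in the memory sufficiently. -/
def MemLocalOpt (v : Fin n → Finset (Fin m) → ℝ) (l p Q : ℕ) (μ : Mem) : Prop :=
  LocalOpt l p (deficit v (μ.real 0 0) p) (threshold m Q p (μ.real 0 0)) (agOf m μ) (levOf m μ)

theorem threshold_nonneg (Q p : ℕ) {τ : ℝ} (hτ : 0 ≤ τ) : 0 ≤ threshold m Q p τ := by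
  unfold threshold; positivity

theorem wp_sweep {l p Q : ℕ} (hp : 1 ≤ p) (hm : m ≤ b) (hn : n ≤ b) (hl : l ≤ b)
    {ag₀ lev₀ : Fin m → ℕ} {μ₀ : Mem} (hτ : 0 ≤ μ₀.real 0 0)
    (h : Searching v l p ag₀ lev₀ μ₀ μ) :
    WP v b (sweep n l p Q) (fun μ' => Searching v l p ag₀ lev₀ μ₀ μ' ∧ μ'.nat 9 = μ.nat 9 ∧
      (MemLocalOpt v l p Q μ → MemLocalOpt v l p Q μ') ∧
      (¬ MemLocalOpt v l p Q μ → memPotential v l p μ' + threshold m Q p (μ₀.real 0 0)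
        ≤ memPotential v l p μ)) μ := by
  set bd : ℕ → ℕ := fun x => if x = 6 then m else if x = 7 then n else l with hbd
  have hτμ : ∀ μ', Searching v l p ag₀ lev₀ μ₀ μ' → μ'.real 0 0 = μ₀.real 0 0 := fun μ' h' => by
    rw [h'.frame.real 0 (by decide)]
  have hη := threshold_nonneg (m := m) Q p hτ
  -- Every attempt either leaves the state alone, and then the attempted move does not improve it,
  -- or lowers the potential and thereby shows that the state was not locally optimal.
  have step : ∀ μ', Searching v l p ag₀ lev₀ μ₀ μ' →
      (∀ y ∈ [(6, var 0), (7, NExpr.const n), (8, NExpr.const l)], μ'.nat y.1 0 < bd y.1) →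
      WP v b (tryMove n l p Q) (fun μ'' => Searching v l p ag₀ lev₀ μ₀ μ'' ∧
        (∀ y ∈ [(6, var 0), (7, NExpr.const n), (8, NExpr.const l)],
          μ''.nat y.1 0 = μ'.nat y.1 0) ∧ μ''.nat 9 = μ'.nat 9 ∧
        ((agOf m μ'' = agOf m μ' ∧ levOf m μ'' = levOf m μ' ∧ ∀ j : Fin m, μ'.nat 6 0 = j →
            ¬ (levOf m μ' j < l ∧ movePotential v l p μ' j (μ'.nat 7 0) (μ'.nat 8 0)
              + threshold m Q p (μ₀.real 0 0) ≤ memPotential v l p μ')) ∨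
          (memPotential v l p μ'' + threshold m Q p (μ₀.real 0 0) ≤ memPotential v l p μ' ∧
            ¬ MemLocalOpt v l p Q μ'))) μ' := by
    intro μ' h' hlt
    have l6 : μ'.nat 6 0 < m := by simpa [hbd] using hlt (6, var 0) (by simp)
    have l7 : μ'.nat 7 0 < n := by simpa [hbd] using hlt (7, .const n) (by simp)
    have l8 : μ'.nat 8 0 < l := by simpa [hbd] using hlt (8, .const l) (by simp)
    refine (wp_tryMove (j := ⟨μ'.nat 6 0, l6⟩) h'.items hm hp h'.cur rfl rfl rfl).mono ?_
    rintro μ'' ⟨f, hc, hif⟩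
    rw [hτμ μ' h'] at hif
    have f' : Frame [2, 3, 4, 5, 6, 7, 8, 9, 10, 11] [1, 2, 3] μ₀ μ'' :=
      h'.frame.trans f (by simp) (by simp) (by simp) (by simp)
    have hm'' : μ''.nat 0 0 = m := by rw [f.nat 0 (by decide), h'.items]
    have hcnt : ∀ y ∈ [(6, var 0), (7, NExpr.const n), (8, NExpr.const l)],
        μ''.nat y.1 0 = μ'.nat y.1 0 := by
      intro y hy
      simp only [List.mem_cons, List.not_mem_nil, or_false] at hy
      rcases hy with rfl | rfl | rfl <;> rw [f.nat _ (by simp)]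
    split_ifs at hif with hcond
    · have hr : Reach n l ag₀ lev₀ (agOf m μ'') (levOf m μ'') := by
        rw [hif.1, hif.2]; exact h'.reach.update hcond.1 l7 l8
      refine ⟨⟨f', hm'', hr, hc⟩, hcnt, f.nat 9 (by decide), Or.inr ⟨?_, fun hopt => ?_⟩⟩
      · rw [memPotential, hif.1, hif.2, f.real 0 (by decide)]
        exact hcond.2
      · have h1 := hopt ⟨μ'.nat 6 0, l6⟩ hcond.1 _ l7 _ l8
        rw [hτμ μ' h'] at h1
        have h2 := hcond.2
        rw [movePotential, memPotential, hτμ μ' h'] at h2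
        linarith
    · have hr : Reach n l ag₀ lev₀ (agOf m μ'') (levOf m μ'') := by
        rw [hif.1, hif.2]; exact h'.reach
      refine ⟨⟨f', hm'', hr, hc⟩, hcnt, f.nat 9 (by decide), Or.inl ⟨hif.1, hif.2, ?_⟩⟩
      intro j hj
      obtain rfl : j = ⟨μ'.nat 6 0, l6⟩ := Fin.ext hj.symm
      exact hcond
  have hnodup : ([(6, var 0), (7, NExpr.const n), (8, NExpr.const l)].map Prod.fst).Nodup := by
    simp
  have hbdb : ∀ y ∈ [(6, var 0), (7, NExpr.const n), (8, NExpr.const l)], bd y.1 ≤ b := by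
    simp [hbd, hm, hn, hl]
  have heval : ∀ y ∈ [(6, var 0), (7, NExpr.const n), (8, NExpr.const l)], ∀ μ',
      Searching v l p ag₀ lev₀ μ₀ μ' → y.2.eval μ' = bd y.1 := by
    intro y hy μ' h'
    simp only [List.mem_cons, List.not_mem_nil, or_false] at hy
    rcases hy with rfl | rfl | rfl <;> simp [hbd, NExpr.eval, h'.items]
  have hmem : ∀ y ∈ [(6, var 0), (7, NExpr.const n), (8, NExpr.const l)],
      y.1 ∈ [6, 7, 8, 9] ∧ 9 ≠ y.1 ∧ 2 ≠ y.1 ∧ 3 ≠ y.1 := by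
    simp
  have hset9 : ∀ (μ' : Mem) {x : ℕ} (r : ℕ), 9 ≠ x → (μ'.setNat x 0 r).nat 9 = μ'.nat 9 := by
    intro μ' x r hx; funext i; simp [hx]
  by_cases hopt : MemLocalOpt v l p Q μ
  · refine (wp_nest _ (bd := bd) (I := fun μ' => Searching v l p ag₀ lev₀ μ₀ μ' ∧
      μ'.nat 9 = μ.nat 9 ∧ agOf m μ' = agOf m μ ∧ levOf m μ' = levOf m μ) hnodup hbdb ?_
      (fun y hy μ' h' => heval y hy μ' h'.1) ?_ ⟨h, rfl, rfl, rfl⟩).mono ?_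
    · rintro y hy μ' r ⟨h1, h2, h3, h4⟩
      obtain ⟨e1, e2, e3, e4⟩ := hmem y hy
      exact ⟨h1.setNat e1 r, by rw [hset9 _ _ e2, h2], by rw [agOf_setNat_of_ne _ e3, h3],
        by rw [levOf_setNat_of_ne _ e4, h4]⟩
    · rintro μ' ⟨h1, h2, h3, h4⟩ hlt
      refine (step μ' h1 hlt).mono ?_
      rintro μ'' ⟨k1, k2, k3, k4⟩
      rcases k4 with ⟨k4, k5, -⟩ | ⟨-, k4⟩
      · exact ⟨⟨k1, k3.trans h2, k4.trans h3, k5.trans h4⟩, k2⟩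
      · refine absurd ?_ k4
        unfold MemLocalOpt at hopt ⊢
        rwa [h3, h4, hτμ μ' h1, ← hτμ μ h]
    · rintro μ' ⟨h1, h2, h3, h4⟩
      refine ⟨h1, h2, fun _ => ?_, fun h => absurd hopt h⟩
      unfold MemLocalOpt at hopt ⊢
      rwa [h3, h4, hτμ μ' h1, ← hτμ μ h]
  · have hopt' := hopt
    unfold MemLocalOpt LocalOpt at hopt'
    push Not at hopt'
    obtain ⟨j, hj, i, hi, k, hk, hle⟩ := hopt'
    -- The goal is the iteration of one fixed improving move of the initial state. When it comes up,
    -- either another move has already lowered the potential, or the state is still the initial one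
    -- and the move is carried out. Later moves never raise the potential.
    refine (wp_nest_goal _ (bd := bd) (g := fun x => if x = 6 then j else if x = 7 then i else k)
      (I := fun μ' => Searching v l p ag₀ lev₀ μ₀ μ' ∧ μ'.nat 9 = μ.nat 9 ∧
        ((agOf m μ' = agOf m μ ∧ levOf m μ' = levOf m μ) ∨
          memPotential v l p μ' + threshold m Q p (μ₀.real 0 0) ≤ memPotential v l p μ))
      (G := fun μ' => memPotential v l p μ' + threshold m Q p (μ₀.real 0 0)
        ≤ memPotential v l p μ) hnodup hbdb ?_ ?_ ?_
      (fun y hy μ' h' => heval y hy μ' h'.1) ?_ ⟨h, rfl, Or.inl ⟨rfl, rfl⟩⟩).mono ?_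
    · simp [hbd, hi, hk]
    · rintro y hy μ' r ⟨h1, h2, h3⟩
      obtain ⟨e1, e2, e3, e4⟩ := hmem y hy
      refine ⟨h1.setNat e1 r, by rw [hset9 _ _ e2, h2], ?_⟩
      rw [memPotential, agOf_setNat_of_ne _ e3, levOf_setNat_of_ne _ e4]
      exact h3
    · intro y hy μ' r h1
      obtain ⟨e1, e2, e3, e4⟩ := hmem y hy
      rw [memPotential, agOf_setNat_of_ne _ e3, levOf_setNat_of_ne _ e4]
      exact h1
    · rintro μ' ⟨h1, h2, h3⟩ hlt
      refine (step μ' h1 hlt).mono ?_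
      rintro μ'' ⟨k1, k2, k3, k4⟩
      have hτ' := (hτμ μ' h1).trans (hτμ μ h).symm
      have hτ'' := (hτμ μ'' k1).trans (hτμ μ h).symm
      have hsame : ∀ μ', Searching v l p ag₀ lev₀ μ₀ μ' → agOf m μ' = agOf m μ →
          levOf m μ' = levOf m μ → memPotential v l p μ' = memPotential v l p μ := by
        intro μ' h a1 a2
        rw [memPotential, memPotential, a1, a2, hτμ μ' h, hτμ μ ‹_›]
      rcases k4 with ⟨k4, k5, k6⟩ | ⟨k4, -⟩
      · have hpot : memPotential v l p μ'' = memPotential v l p μ' := by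
          rw [memPotential, memPotential, k4, k5, hτ', hτ'']
        refine ⟨⟨k1, k3.trans h2, ?_⟩, k2, ?_⟩
        · rw [k4, k5, hpot]; exact h3
        · rw [hpot]
          rintro (hG | hG)
          · exact hG
          · rcases h3 with ⟨a1, a2⟩ | h3
            · refine absurd ?_ (k6 j (by simpa using hG (6, var 0) (by simp)))
              have g7 : μ'.nat 7 0 = i := by simpa using hG (7, .const n) (by simp)
              have g8 : μ'.nat 8 0 = k := by simpa using hG (8, .const l) (by simp)
              rw [a2, g7, g8, movePotential, memPotential, a1, a2, hτ']
              rw [← hτμ μ h]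
              exact ⟨hj, hle⟩
            · exact h3
      · have hle' : memPotential v l p μ'' + threshold m Q p (μ₀.real 0 0)
            ≤ memPotential v l p μ := by
          rcases h3 with ⟨a1, a2⟩ | h3
          · rw [← hsame μ' h1 a1 a2]; exact k4
          · linarith
        exact ⟨⟨k1, k3.trans h2, Or.inr hle'⟩, k2, fun _ => hle'⟩
    · rintro μ' ⟨⟨h1, h2, -⟩, h3⟩
      exact ⟨h1, h2, fun h => absurd h hopt, fun _ => h3⟩

/-- The sum of the weights of all sets of levels. -/
def totalWeight (l p : ℕ) : ℕ := ∑ J ∈ (Finset.range l).powerset, levelWeight l p J.card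

/-- The number of sweeps for one item. -/
def sweepFactor (n l p Q : ℕ) : ℕ := n * totalWeight l p * Q + 1

/-- The local search. -/
noncomputable def search (n l p Q : ℕ) : Prog :=
  forLoop 9 ((NExpr.add (var 0) (.const 1)).nsmul (sweepFactor n l p Q)) (sweep n l p Q)

theorem memPotential_nonneg (l p : ℕ) (μ : Mem) : 0 ≤ memPotential v l p μ := by
  unfold memPotential potential deficit
  exact Finset.sum_nonneg fun _ _ => Finset.sum_nonneg fun _ _ =>
    mul_nonneg (Nat.cast_nonneg _) (pow_nonneg (shortfall_nonneg _ _ _) p)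

theorem memPotential_le (hv : ∀ i, IsValuation (v i)) (l p : ℕ) (hτ : 0 ≤ μ.real 0 0) :
    memPotential v l p μ ≤ n * totalWeight l p * μ.real 0 0 ^ p := by
  calc memPotential v l p μ ≤ ∑ _i : Fin n, ∑ J ∈ (Finset.range l).powerset,
        (levelWeight l p J.card : ℝ) * μ.real 0 0 ^ p := by
        unfold memPotential potential deficit
        exact Finset.sum_le_sum fun i _ => Finset.sum_le_sum fun J _ =>
          mul_le_mul_of_nonneg_left (pow_le_pow_left₀ (shortfall_nonneg _ _ _)
            (shortfall_le hτ (hv i) _) p) (Nat.cast_nonneg _)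
    _ = n * totalWeight l p * μ.real 0 0 ^ p := by
        simp [totalWeight, Finset.sum_mul, Finset.mul_sum, mul_assoc]

/-- If no local optimum were reached, every sweep would lower the potential by the threshold, and in
total by more than its initial value. For target zero the threshold vanishes and local optimality is
not claimed. -/
theorem wp_search (hv : ∀ i, IsValuation (v i)) {l p Q : ℕ} (hp : 1 ≤ p) (hQ : 0 < Q)
    (hm : m ≤ b) (hn : n ≤ b) (hl : l ≤ b) (hs : sweepFactor n l p Q * (m + 1) ≤ b)
    (hτ : 0 ≤ μ.real 0 0) (hitems : μ.nat 0 0 = m) (hag : ∀ j, agOf m μ j < n)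
    (hcur : μ.real 3 0 = memPotential v l p μ) :
    WP v b (search n l p Q) (fun μ' => Searching v l p (agOf m μ) (levOf m μ) μ μ' ∧
      (0 < μ.real 0 0 → MemLocalOpt v l p Q μ')) μ := by
  have hinit : Searching v l p (agOf m μ) (levOf m μ) μ μ :=
    ⟨Frame.refl _ _ _, hitems, fun j => ⟨hag j, Iff.rfl, fun _ => rfl⟩, hcur⟩
  have hset : ∀ (μ' : Mem) (r : ℕ), memPotential v l p (μ'.setNat 9 0 r) = memPotential v l p μ' ∧
      (MemLocalOpt v l p Q (μ'.setNat 9 0 r) ↔ MemLocalOpt v l p Q μ') := by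
    intro μ' r
    unfold memPotential MemLocalOpt
    rw [agOf_setNat_of_ne _ (by decide), levOf_setNat_of_ne _ (by decide)]
    exact ⟨rfl, Iff.rfl⟩
  refine wp_for (N := sweepFactor n l p Q * (m + 1)) hs
    (I := fun k μ' => Searching v l p (agOf m μ) (levOf m μ) μ μ' ∧ μ'.nat 9 0 = k ∧
      (memPotential v l p μ' + k * threshold m Q p (μ.real 0 0) ≤ memPotential v l p μ ∨
        MemLocalOpt v l p Q μ')) ?_ ?_ ?_ ?_
  · refine ⟨hinit.setNat (by simp) _, by simp, Or.inl ?_⟩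
    rw [(hset μ 0).1]
    simp
  · rintro k μ' ⟨h1, h2, -⟩
    exact ⟨h2, by simp [NExpr.eval, h1.items]⟩
  · rintro k hk μ' ⟨h1, h2, h3⟩
    refine (wp_sweep hp hm hn hl hτ h1).mono ?_
    rintro μ'' ⟨k1, k2, k3, k4⟩
    refine ⟨by rw [k2, h2], k1.setNat (by simp) _, by simp, ?_⟩
    rw [(hset μ'' _).1, (hset μ'' _).2]
    by_cases hopt : MemLocalOpt v l p Q μ'
    · exact Or.inr (k3 hopt)
    · refine Or.inl ?_
      have h4 := h3.resolve_right hopt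
      have h5 := k4 hopt
      push_cast
      linarith
  · rintro μ' ⟨h1, -, h3⟩
    refine ⟨h1, fun hpos => h3.resolve_left fun hle => ?_⟩
    have h4 := memPotential_nonneg (v := v) l p μ'
    have h5 := memPotential_le (v := v) hv l p hτ
    have hQ' : (0 : ℝ) < Q := by exact_mod_cast hQ
    have hτp : 0 < μ.real 0 0 ^ p := by positivity
    -- The summand `1` in `sweepFactor` provides the surplus `τ ^ p / Q`, which makes the
    -- contradiction strict.
    have h6 : ((sweepFactor n l p Q * (m + 1) : ℕ) : ℝ) * threshold m Q p (μ.real 0 0)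
        = n * totalWeight l p * μ.real 0 0 ^ p + μ.real 0 0 ^ p / Q := by
      unfold threshold sweepFactor
      push_cast
      field_simp
    have h7 : 0 < μ.real 0 0 ^ p / Q := by positivity
    linarith

end Search

/-! ### A single guess, and the enumeration of all guesses. -/

section Main

variable {n m : ℕ} {v : Fin n → Finset (Fin m) → ℝ} {b : ℕ} {μ : Mem}

/-- Assign all items to agent `0` at level `0`, then pin the guessed items. -/
def initState (n l K : ℕ) : Prog :=
  .seq (forLoop 5 (var 0)
      (.seq (.setNat 2 (var 5) (.const 0)) (.setNat 3 (var 5) (.const 0))))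
    (seqs ((List.range (n * K)).map fun s =>
      .seq (.setNat 2 (var (20 + s)) (.const (s % n))) (.setNat 3 (var (20 + s)) (.const l))))

/-- A slot containing `m` names no item, and its writes do not affect any item. If several slots
name the same item, the last one determines the owner; the statement only records that some slot
does. -/
theorem wp_initState (hitems : μ.nat 0 0 = m) (hm : m ≤ b) (l K : ℕ) :
    WP v b (initState n l K) (fun μ' => Frame [2, 3, 5] [] μ μ' ∧ ∀ j : Fin m,
      (∃ s < n * K, μ.nat (20 + s) 0 = j ∧ agOf m μ' j = s % n ∧ levOf m μ' j = l) ∨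
      ((∀ s < n * K, μ.nat (20 + s) 0 ≠ j) ∧ agOf m μ' j = 0 ∧ levOf m μ' j = 0)) μ := by
  refine wp_seq (wp_for (N := m) (I := fun k μ' => Frame [2, 3, 5] [] μ μ' ∧ μ'.nat 5 0 = k ∧
    ∀ j : Fin m, j < k → agOf m μ' j = 0 ∧ levOf m μ' j = 0) hm ?_ ?_ ?_ ?_)
  · exact ⟨(Frame.refl _ _ μ).setNat (by decide) _ _, by simp, fun j hj => by omega⟩
  · rintro k μ' ⟨h1, h2, -⟩
    exact ⟨h2, by rw [NExpr.eval_var, h1.nat 0 (by decide), hitems]⟩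
  · rintro k hk μ' ⟨h1, h2, h3⟩
    refine wp_seq (wp_setNat (wp_setNat ⟨by simp [h2], (((h1.setNat (by decide) _ _).setNat
      (by decide) _ _).setNat (by decide) _ _), by simp, fun j hj => ?_⟩))
    rcases Nat.lt_succ_iff_lt_or_eq.1 hj with hj | hj
    · have := h3 j hj
      simpa [agOf, levOf, h2, hj.ne, NExpr.eval] using this
    · simp [agOf, levOf, h2, hj, NExpr.eval]
  · rintro μ₁ ⟨h1, -, h3⟩
    refine wp_seqs_map _ (I := fun L μ' => Frame [2, 3, 5] [] μ μ' ∧ ∀ j : Fin m,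
      (∃ s ∈ L, μ.nat (20 + s) 0 = j ∧ agOf m μ' j = s % n ∧ levOf m μ' j = l) ∨
      ((∀ s ∈ L, μ.nat (20 + s) 0 ≠ j) ∧ agOf m μ' j = 0 ∧ levOf m μ' j = 0)) ?_ ?_ ?_
    · exact ⟨h1, fun j => Or.inr ⟨by simp, h3 j j.2⟩⟩
    · rintro L₁ s L₂ - μ₂ ⟨k1, k2⟩
      have e : μ₂.nat (20 + s) 0 = μ.nat (20 + s) 0 := by
        rw [k1.nat (20 + s) (by simp only [List.mem_cons, List.not_mem_nil, or_false]; omega)]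
      have e3 : 20 + s ≠ 2 := by omega
      refine wp_seq (wp_setNat (wp_setNat ⟨(k1.setNat (by decide) _ _).setNat (by decide) _ _,
        fun j => ?_⟩))
      by_cases hj : μ.nat (20 + s) 0 = j
      · exact Or.inl ⟨s, by simp, hj, by simp [agOf, NExpr.eval, e, hj],
          by simp [levOf, NExpr.eval, e, hj, e3]⟩
      · have hj' : (j : ℕ) ≠ μ₂.nat (20 + s) 0 := fun h => hj (by rw [← e, h])
        rcases k2 j with ⟨s', a1, a2, a3, a4⟩ | ⟨a1, a2, a3⟩
        · refine Or.inl ⟨s', by simp [a1], a2, ?_, ?_⟩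
          · rw [← a3]; simp [agOf, NExpr.eval, hj']
          · rw [← a4]; simp [levOf, NExpr.eval, hj', e3]
        · refine Or.inr ⟨?_, ?_, ?_⟩
          · intro s' hs'
            rcases List.mem_append.1 hs' with hs' | hs'
            · exact a1 s' hs'
            · rw [List.mem_singleton.1 hs']; exact hj
          · rw [← a2]; simp [agOf, NExpr.eval, hj']
          · rw [← a3]; simp [levOf, NExpr.eval, hj', e3]
    · rintro μ' ⟨k1, k2⟩
      refine ⟨k1, fun j => ?_⟩
      simpa only [List.mem_range] using k2 j

/-- The target given by the counters. -/
def setTarget (N : ℕ) : Prog :=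
  .seq (querySet (.eq (var 5) (var 13)) (var 12))
    (.setReal 0 (.const 0) (.div (.mul (rvar 2) (.cast (var 14))) (.cast (.const N))))

theorem wp_setTarget (hitems : μ.nat 0 0 = m) (hm : m ≤ b) (N : ℕ) {i : Fin n} {j : Fin m}
    (hi : μ.nat 12 0 = i) (hj : μ.nat 13 0 = j) :
    WP v b (setTarget N) (fun μ' => Frame [4, 5] [0, 2] μ μ' ∧
      μ'.real 0 0 = v i {j} * μ.nat 14 0 / N) μ := by
  refine wp_seq ((wp_querySet (i := i) (S := {j}) hitems hm (fun μ' h => ?_)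
    (fun μ' h j' hj' => ?_)).mono ?_)
  · rw [NExpr.eval_var, h.nat 12 (by decide), hi]
  · rw [Test.holds_eq, NExpr.eval_var, NExpr.eval_var, h.nat 13 (by decide), hj, hj',
      Finset.mem_singleton, Fin.val_inj]
  · rintro μ' ⟨h1, h2⟩
    refine wp_setReal ⟨?_, ?_⟩
    · exact (h1.trans (Frame.refl [4, 5] [0, 2] μ') (by simp) (by simp) (by simp) (by simp)).setReal
        (by simp) _ _
    · simp [RExpr.eval, NExpr.eval, h2, h1.nat 14]

/-- The minimum of the target and of the values of the current allocation. -/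
noncomputable def evaluate (n l : ℕ) : Prog :=
  .seq (.setReal 5 (.const 0) (rvar 0))
    (seqs ((List.finRange n).map fun i : Fin n =>
      .seq (querySet (partTest l i (Finset.range l)) (.const i))
        (.ite (.realLe (rvar 2) (rvar 5)) (.setReal 5 (.const 0) (rvar 2)) .skip)))

/-- The minimum is initialized with the target instead of infinity. This loses nothing, because only
a lower bound of the form `(1 - γ) * τ` is needed. -/
theorem wp_evaluate (hitems : μ.nat 0 0 = m) (hm : m ≤ b) (l : ℕ) :
    WP v b (evaluate n l) (fun μ' => Frame [4, 5] [2, 5] μ μ' ∧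
      (∀ i : Fin n, μ'.real 5 0 ≤ v i (part l (agOf m μ) (levOf m μ) i (Finset.range l))) ∧
      ∀ x ≤ μ.real 0 0, (∀ i : Fin n, x ≤ v i (part l (agOf m μ) (levOf m μ) i (Finset.range l))) →
        x ≤ μ'.real 5 0) μ := by
  set w : Fin n → ℝ := fun i => v i (part l (agOf m μ) (levOf m μ) i (Finset.range l)) with hw
  refine wp_seq (wp_setReal (wp_seqs_map _ (I := fun L μ' => Frame [4, 5] [2, 5] μ μ' ∧
    (∀ i ∈ L, μ'.real 5 0 ≤ w i) ∧
    ∀ x ≤ μ.real 0 0, (∀ i : Fin n, x ≤ w i) → x ≤ μ'.real 5 0) ?_ ?_ ?_))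
  · refine ⟨(Frame.refl _ _ μ).setReal (by decide) _ _, by simp, fun x hx _ => ?_⟩
    simpa [NExpr.eval] using hx
  · rintro L₁ i L₂ - μ₁ ⟨h1, h2, h3⟩
    have hm₁ : μ₁.nat 0 0 = m := by rw [h1.nat 0 (by decide), hitems]
    refine wp_seq ((wp_queryPart hm₁ hm l i (Finset.range l)).mono ?_)
    rintro μ₂ ⟨h4, h5⟩
    have h6 : Frame [4, 5] [2, 5] μ μ₂ := h1.trans h4 (by simp) (by simp) (by simp) (by simp)
    rw [h1.agOf_eq (by decide), h1.levOf_eq (by decide)] at h5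
    have h5' : μ₂.real 2 0 = w i := h5
    have h7 : μ₂.real 5 0 = μ₁.real 5 0 := by rw [h4.real 5 (by decide)]
    refine wp_ite (fun h => wp_setReal ⟨h6.setReal (by decide) _ _, ?_, ?_⟩)
      (fun h => wp_skip ⟨h6, ?_, ?_⟩)
    · simp only [Test.Holds, RExpr.eval_rvar, h5', h7] at h
      intro i' hi'
      simp only [NExpr.eval, RExpr.eval_rvar, setReal_real, and_self, if_true, h5']
      rcases List.mem_append.1 hi' with hi' | hi'
      · exact h.trans (h2 i' hi')
      · rw [List.mem_singleton.1 hi']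
    · intro x _ hx'
      simp only [NExpr.eval, RExpr.eval_rvar, setReal_real, and_self, if_true, h5']
      exact hx' i
    · simp only [Test.Holds, RExpr.eval_rvar, h5', h7, not_le] at h
      intro i' hi'
      rw [h7]
      rcases List.mem_append.1 hi' with hi' | hi'
      · exact h2 i' hi'
      · rw [List.mem_singleton.1 hi']; exact h.le
    · intro x hx hx'
      rw [h7]; exact h3 x hx hx'
  · rintro μ' ⟨h1, h2, h3⟩
    exact ⟨h1, fun i => h2 i (List.mem_finRange i), h3⟩

/-- The array `1` holds an allocation that gives at least the value `x` to every agent. -/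
def Achieves (v : Fin n → Finset (Fin m) → ℝ) (x : ℝ) (μ : Mem) : Prop :=
  ∃ A : Fin m → Fin n, (∀ j : Fin m, μ.nat 1 j = A j) ∧ ∀ i, x ≤ v i (bundle A i)

/-- Keep the current allocation if it is the best one so far. -/
def keepBest : Prog :=
  .ite (.realLe (rvar 4) (rvar 5))
    (.seq (.setReal 4 (.const 0) (rvar 5))
      (forLoop 5 (var 0) (.setNat 1 (var 5) (.read 2 (var 5))))) .skip

theorem wp_keepBest (hitems : μ.nat 0 0 = m) (hm : m ≤ b) {l : ℕ}
    (hag : ∀ j, agOf m μ j < n)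
    (hcand : ∀ i : Fin n,
      μ.real 5 0 ≤ v i (part l (agOf m μ) (levOf m μ) i (Finset.range l)))
    (hbest : Achieves v (μ.real 4 0) μ) :
    WP v b keepBest (fun μ' => Frame [1, 5] [4] μ μ' ∧ Achieves v (μ'.real 4 0) μ' ∧
      μ.real 4 0 ≤ μ'.real 4 0 ∧ μ.real 5 0 ≤ μ'.real 4 0) μ := by
  refine wp_ite (fun h => wp_seq (wp_setReal ?_)) (fun h => wp_skip ?_)
  · refine wp_for (N := m) hm (I := fun k μ' => Frame [1, 5] [4] μ μ' ∧ μ'.nat 5 0 = k ∧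
      μ'.real 4 0 = μ.real 5 0 ∧ ∀ j : Fin m, j < k → μ'.nat 1 j = agOf m μ j) ?_ ?_ ?_ ?_
    · refine ⟨((Frame.refl _ _ μ).setReal (by decide) _ _).setNat (by decide) _ _, by simp,
        by simp [NExpr.eval], fun j hj => by omega⟩
    · rintro k μ' ⟨h1, h2, -⟩
      exact ⟨h2, by rw [NExpr.eval_var, h1.nat 0 (by decide), hitems]⟩
    · rintro k hk μ' ⟨h1, h2, h3, h4⟩
      refine wp_setNat ⟨by simp [h2], (h1.setNat (by decide) _ _).setNat (by decide) _ _,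
        by simp, by simp [h3], fun j hj => ?_⟩
      rcases Nat.lt_succ_iff_lt_or_eq.1 hj with hj | hj
      · simpa [h2, hj.ne] using h4 j hj
      · simp [h2, hj, NExpr.eval, h1.nat 2, agOf]
    · rintro μ' ⟨h1, -, h3, h4⟩
      refine ⟨h1, ⟨fun j => ⟨agOf m μ j, hag j⟩, fun j => h4 j j.2, fun i => ?_⟩, ?_, h3.ge⟩
      · rw [h3]
        refine (hcand i).trans_eq ?_
        congr 1
        -- Every item is either pinned or has one of the levels below `l`, so the part for all
        -- levels is the whole bundle.
        ext j
        simp only [part, bundle, Finset.mem_filter, Finset.mem_univ, true_and, Finset.mem_range,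
          Fin.ext_iff]
        omega
      · rw [h3]; simpa [Test.Holds] using h
  · simp only [Test.Holds, RExpr.eval_rvar, not_le] at h
    exact ⟨Frame.refl _ _ _, hbest, le_rfl, h.le⟩

/-- The local search for one guess. -/
noncomputable def tryGuess (n l p K Q N : ℕ) : Prog :=
  .seq (setTarget N) <| .seq (initState n l K) <| .seq (computePotential n l p) <|
    .seq (.setReal 3 (.const 0) (rvar 1)) <| .seq (search n l p Q) <|
    .seq (evaluate n l) keepBest

/-- For any guess the record remains a valid allocation and does not get worse. The last clause
concerns correct guesses, where the slots name exactly the items of the sets `B i` and slot `s`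
serves agent `s % n`. The allocation `O` and the pins `B` belong to the analysis and are unknown to
the program. -/
theorem wp_tryGuess (hv : ∀ i, IsValuation (v i)) {l p K Q N : ℕ} {γ : ℝ} (hp : 1 ≤ p)
    (hl1 : 1 ≤ l) (hQ : 0 < Q) (hm : m ≤ b) (hn : n ≤ b) (hl : l ≤ b)
    (hs : sweepFactor n l p Q * (m + 1) ≤ b) (hγ : 0 ≤ γ)
    (hpar : (n * ((l : ℝ) ^ l * l.factorial)
        + n * (∑ J ∈ (Finset.range l).powerset, (levelWeight l p J.card : ℝ) * J.card)
            * (p ^ 2 * (1 / K)) + l / Q) ≤ γ ^ p * (((l : ℝ) + p) ^ l * l.factorial))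
    (hitems : μ.nat 0 0 = m) {i₀ : Fin n} {j₀ : Fin m} (hi : μ.nat 12 0 = i₀)
    (hj : μ.nat 13 0 = j₀) (hbest : Achieves v (μ.real 4 0) μ) :
    WP v b (tryGuess n l p K Q N) (fun μ' =>
      Frame [1, 2, 3, 4, 5, 6, 7, 8, 9, 10, 11] [0, 1, 2, 3, 4, 5] μ μ' ∧
      Achieves v (μ'.real 4 0) μ' ∧ μ.real 4 0 ≤ μ'.real 4 0 ∧
      ∀ τ, τ = v i₀ {j₀} * μ.nat 14 0 / N → 0 < τ →
        ∀ (O : Fin m → Fin n) (B : Fin n → Finset (Fin m)), (∀ i, τ ≤ v i (bundle O i)) →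
        (∀ i, B i ⊆ bundle O i) →
        (∀ i, ∀ j ∈ bundle O i, ∀ S, B i ⊆ S →
          shortfall τ (v i) S - shortfall τ (v i) (insert j S) ≤ 1 / K * τ) →
        (∀ s < n * K, ∀ j : Fin m, μ.nat (20 + s) 0 = j → ∃ i : Fin n, s % n = i ∧ j ∈ B i) →
        (∀ i, ∀ j ∈ B i, ∃ s < n * K, μ.nat (20 + s) 0 = j) →
        (1 - γ) * τ ≤ μ'.real 4 0) μ := by
  have hn0 : 0 < n := i₀.pos
  refine wp_seq ((wp_setTarget hitems hm N hi hj).mono ?_)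
  rintro μ₁ ⟨f₁, hτ₁⟩
  have hτ0 : 0 ≤ v i₀ {j₀} * μ.nat 14 0 / N :=
    div_nonneg (mul_nonneg ((hv i₀).nonneg _) (Nat.cast_nonneg _)) (Nat.cast_nonneg _)
  set τ := v i₀ {j₀} * μ.nat 14 0 / N with hτdef
  refine wp_seq ((wp_initState (by rw [f₁.nat 0 (by decide), hitems]) hm l K).mono ?_)
  rintro μ₂ ⟨f₂, hinit⟩
  have g₂ : Frame [2, 3, 4, 5, 6, 7, 8, 9, 10, 11] [0, 1, 2, 3, 5] μ μ₂ :=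
    f₁.trans f₂ (by simp) (by simp) (by simp) (by simp)
  have hm₂ : μ₂.nat 0 0 = m := by rw [g₂.nat 0 (by decide), hitems]
  have hτ₂ : μ₂.real 0 0 = τ := by rw [f₂.real 0 (by decide), hτ₁]
  refine wp_seq ((wp_computePotential hm₂ hm l hp).mono ?_)
  rintro μ₃ ⟨f₃, hpot⟩
  refine wp_seq (wp_setReal ?_)
  simp only [NExpr.eval, RExpr.eval_rvar]
  set μ₄ := μ₃.setReal 3 0 (μ₃.real 1 0) with hμ₄
  have f₄ : Frame [4, 5] [1, 2, 3] μ₂ μ₄ :=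
    (f₃.trans (Frame.refl [4, 5] [1, 2, 3] μ₃) (by simp) (by simp) (by simp) (by simp)).setReal
      (by simp) _ _
  have g₄ : Frame [2, 3, 4, 5, 6, 7, 8, 9, 10, 11] [0, 1, 2, 3, 5] μ μ₄ :=
    g₂.trans f₄ (by simp) (by simp) (by simp) (by simp)
  have ag₄ := f₄.agOf_eq (m := m) (by decide)
  have lev₄ := f₄.levOf_eq (m := m) (by decide)
  have hm₄ : μ₄.nat 0 0 = m := by rw [g₄.nat 0 (by decide), hitems]
  have hτ₄ : μ₄.real 0 0 = τ := by rw [f₄.real 0 (by decide), hτ₂]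
  have hcur : μ₄.real 3 0 = memPotential v l p μ₄ := by
    rw [memPotential, ag₄, lev₄, hτ₄, ← hτ₂, ← hpot]
    simp [hμ₄]
  have hag : ∀ j, agOf m μ₄ j < n := by
    intro j
    rw [ag₄]
    rcases hinit j with ⟨s, -, -, h, -⟩ | ⟨-, h, -⟩
    · rw [h]; exact Nat.mod_lt _ hn0
    · rw [h]; exact hn0
  have hlev₄ : ∀ j, levOf m μ₄ j = l ∨ levOf m μ₄ j = 0 := by
    intro j
    rw [lev₄]
    rcases hinit j with ⟨s, -, -, -, h⟩ | ⟨-, -, h⟩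
    · exact Or.inl h
    · exact Or.inr h
  refine wp_seq ((wp_search hv hp hQ hm hn hl hs (by rw [hτ₄]; exact hτ0) hm₄ hag hcur).mono ?_)
  rintro μ₅ ⟨hsearch, hopt⟩
  have g₅ : Frame [2, 3, 4, 5, 6, 7, 8, 9, 10, 11] [0, 1, 2, 3, 5] μ μ₅ :=
    g₄.trans hsearch.frame (by simp) (by simp) (by simp) (by simp)
  have hτ₅ : μ₅.real 0 0 = τ := by rw [hsearch.frame.real 0 (by decide), hτ₄]
  refine wp_seq ((wp_evaluate hsearch.items hm l).mono ?_)
  rintro μ₆ ⟨f₆, hcand, hcand'⟩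
  have g₆ : Frame [2, 3, 4, 5, 6, 7, 8, 9, 10, 11] [0, 1, 2, 3, 5] μ μ₆ :=
    g₅.trans f₆ (by simp) (by simp) (by simp) (by simp)
  have ag₆ := f₆.agOf_eq (m := m) (by decide)
  have lev₆ := f₆.levOf_eq (m := m) (by decide)
  have hbest₆ : Achieves v (μ₆.real 4 0) μ₆ := by
    unfold Achieves at hbest ⊢
    rw [g₆.real 4 (by decide), g₆.nat 1 (by decide)]
    exact hbest
  refine (wp_keepBest (l := l) (by rw [g₆.nat 0 (by decide), hitems]) hm ?_ ?_ hbest₆).mono ?_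
  · intro j
    rw [ag₆]; exact (hsearch.reach j).1
  · rw [ag₆, lev₆]; exact hcand
  rintro μ₇ ⟨f₇, k1, k2, k3⟩
  refine ⟨g₆.trans f₇ (by simp) (by simp) (by simp) (by simp), k1, ?_, ?_⟩
  · rw [← g₆.real 4 (by decide)]; exact k2
  rintro _ rfl hpos O B hO hBO hB hs₁ hs₂
  refine (hcand' _ ?_ ?_).trans k3
  · rw [hτ₅]
    nlinarith
  have hopt₅ := hopt (by rw [hτ₄]; exact hpos)
  unfold MemLocalOpt at hopt₅
  rw [hτ₅] at hopt₅
  have hnat : ∀ s, μ₁.nat (20 + s) = μ.nat (20 + s) := fun s =>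
    f₁.nat (20 + s) (by simp only [List.mem_cons, List.not_mem_nil, or_false]; omega)
  -- The search changes neither the set of pinned items nor their owners, so each pinned item can be
  -- traced back to a slot.
  have hpins : ∀ j, l ≤ levOf m μ₅ j → ∃ i, agOf m μ₅ j = i ∧ ∃ i' : Fin n, i = i' ∧ j ∈ B i' := by
    intro j hj
    obtain ⟨-, r1, r2⟩ := hsearch.reach j
    have hj₄ := r1.1 hj
    rw [r2 hj₄]
    rw [lev₄] at hj₄
    rw [ag₄]
    rcases hinit j with ⟨s, a1, a2, a3, a4⟩ | ⟨-, -, a3⟩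
    · rw [hnat] at a2
      exact ⟨_, rfl, by rw [a3]; exact hs₁ s a1 j a2⟩
    · omega
  refine LocalOpt.le_value hv hpos hγ hp hl1 hQ hpar hO hB ?_ ?_ hopt₅
  · intro j hj
    obtain ⟨i, a1, i', rfl, a3⟩ := hpins j hj
    have := hBO i' a3
    rw [bundle, Finset.mem_filter] at this
    rw [a1, this.2]
  · intro i j hj
    obtain ⟨s, a1, a2⟩ := hs₂ i j hj
    have hl₄ : levOf m μ₄ j = l := by
      rw [lev₄]
      rcases hinit j with ⟨-, -, -, -, a4⟩ | ⟨a3, -, -⟩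
      · exact a4
      · exact absurd (by rw [hnat]; exact a2) (a3 s a1)
    have hl₅ : l ≤ levOf m μ₅ j := (hsearch.reach j).2.1.2 hl₄.ge
    refine ⟨?_, hl₅⟩
    -- The slot that fixed the owner might serve another agent `i'`; but then `j` would lie in two
    -- bundles of `O`, hence `i' = i`.
    obtain ⟨_, b1, i', rfl, b3⟩ := hpins j hl₅
    have c1 := hBO i' b3
    have c2 := hBO i hj
    rw [bundle, Finset.mem_filter] at c1 c2
    rw [b1, ← c1.2, ← c2.2]

/-- The loops over all guesses. -/
def guessLoops (n K N : ℕ) : List (ℕ × NExpr) :=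
  (12, .const n) :: (13, var 0) :: (14, .add ((var 0).nsmul N) (.const 1)) ::
    (List.range (n * K)).map fun s => (20 + s, .add (var 0) (.const 1))

/-- The algorithm. -/
noncomputable def algorithm (n l p K Q N : ℕ) : Prog :=
  nest (guessLoops n K N) (tryGuess n l p K Q N)

/-- The sets of pins can be written into the slots. -/
theorem exists_slots {K : ℕ} (B : Fin n → Finset (Fin m)) (hB : ∀ i, (B i).card ≤ K) :
    ∃ c : ℕ → ℕ, (∀ s, c s < m + 1) ∧
      (∀ s < n * K, ∀ j : Fin m, c s = j → ∃ i : Fin n, s % n = i ∧ j ∈ B i) ∧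
      ∀ i, ∀ j ∈ B i, ∃ s < n * K, c s = j := by
  rcases Nat.eq_zero_or_pos n with rfl | hn
  · exact ⟨fun _ => 0, fun _ => Nat.succ_pos m, fun s hs => by omega, fun i => i.elim0⟩
  let L : ℕ → List (Fin m) := fun s => (B ⟨s % n, Nat.mod_lt s hn⟩).toList
  -- Slot `n * q + i` holds the pin number `q` of agent `i`, and `m` marks an empty slot.
  refine ⟨fun s => if h : s / n < (L s).length then (L s)[s / n] else m, ?_, ?_, ?_⟩
  · intro s
    dsimp only
    split_ifs with h
    · exact ((L s)[s / n]).2.trans (Nat.lt_succ_self m)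
    · exact Nat.lt_succ_self m
  · intro s hs j hj
    dsimp only at hj
    split_ifs at hj with h
    · refine ⟨⟨s % n, Nat.mod_lt s hn⟩, rfl, ?_⟩
      rw [← Fin.ext hj, ← Finset.mem_toList]
      exact List.getElem_mem h
    · exact absurd hj j.2.ne'
  · intro i j hj
    obtain ⟨q, hq, hqj⟩ := List.mem_iff_getElem.1 (Finset.mem_toList.2 hj)
    have hq' : q < K := by
      rw [Finset.length_toList] at hq
      exact hq.trans_le (hB i)
    have h1 : (n * q + i) % n = i := by
      rw [Nat.mul_add_mod, Nat.mod_eq_of_lt i.2]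
    have h2 : (n * q + i) / n = q := by
      rw [Nat.mul_add_div hn, Nat.div_eq_of_lt i.2, add_zero]
    have hL : L (n * q + i) = (B i).toList := by
      simp only [L, h1]
    refine ⟨n * q + i, ?_, ?_⟩
    · calc n * q + i < n * (q + 1) := by rw [Nat.mul_succ]; exact Nat.add_lt_add_left i.2 _
        _ ≤ n * K := Nat.mul_le_mul_left n hq'
    · simp only [hL, h2, hq, dif_pos, hqj]

theorem mem_guessLoops {K N : ℕ} {y : ℕ × NExpr} (hy : y ∈ guessLoops n K N) :
    y = (12, .const n) ∨ y = (13, var 0) ∨ y = (14, .add ((var 0).nsmul N) (.const 1)) ∨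
      ∃ s < n * K, y = (20 + s, .add (var 0) (.const 1)) := by
  simp only [guessLoops, List.mem_cons, List.mem_map, List.mem_range] at hy
  rcases hy with h | h | h | ⟨s, h1, h2⟩
  · exact Or.inl h
  · exact Or.inr (Or.inl h)
  · exact Or.inr (Or.inr (Or.inl h))
  · exact Or.inr (Or.inr (Or.inr ⟨s, h1, h2.symm⟩))

/-- If the optimum is zero, every allocation is good enough. Otherwise one iteration of the nested
loops carries the correct guess, and the recorded value never decreases afterwards. Half of `ε` is
spent in `gap`, the other half on the grid of targets. -/
theorem wp_algorithm (hv : ∀ i, IsValuation (v i)) (hn1 : 1 ≤ n) {l p K Q N : ℕ} {ε : ℝ}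
    (hε : 0 < ε) (hp : 1 ≤ p) (hl1 : 1 ≤ l) (hK : 0 < K) (hQ : 0 < Q) (hN : 0 < N)
    (hNε : 1 / (N : ℝ) ≤ ε / 2)
    (hpar : (n * ((l : ℝ) ^ l * l.factorial)
        + n * (∑ J ∈ (Finset.range l).powerset, (levelWeight l p J.card : ℝ) * J.card)
            * (p ^ 2 * (1 / K)) + l / Q) ≤ gap ε ^ p * (((l : ℝ) + p) ^ l * l.factorial))
    (hb : (n + l + N + sweepFactor n l p Q) * (m + 1) ≤ b) :
    WP v b (algorithm n l p K Q N)
      (Achieves v (max 0 ((1 - 1 / Real.exp 1 - ε) * opt v)))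
      (start (algorithm n l p K Q N) m).mem := by
  have hbn : n ≤ b := by nlinarith
  have hbl : l ≤ b := by nlinarith
  have hbN : N * m + 1 ≤ b := by nlinarith
  have hbs : sweepFactor n l p Q * (m + 1) ≤ b := by nlinarith
  have hbm : m + 1 ≤ b := by nlinarith
  set bd : ℕ → ℕ := fun x => if x = 12 then n else if x = 13 then m else if x = 14 then N * m + 1
    else m + 1 with hbd
  have hnodup : ((guessLoops n K N).map Prod.fst).Nodup := by
    have h1 : ((List.range (n * K)).map fun s => 20 + s).Nodup :=
      List.nodup_range.map fun a b h => by simpa using h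
    simp only [guessLoops, List.map_cons, List.map_map, List.nodup_cons, List.mem_cons,
      List.mem_map, List.mem_range, Function.comp_apply, not_or, not_exists, not_and]
    exact ⟨⟨by omega, by omega, fun s _ => by omega⟩, ⟨by omega, fun s _ => by omega⟩,
      fun s _ => by omega, h1⟩
  have hbdb : ∀ y ∈ guessLoops n K N, bd y.1 ≤ b := by
    intro y hy
    simp only [hbd]
    split_ifs <;> omega
  set I : Mem → Prop := fun μ => μ.nat 0 0 = m ∧ 0 ≤ μ.real 4 0 ∧ Achieves v (μ.real 4 0) μ
    with hI
  have hne : ∀ y ∈ guessLoops n K N, 0 ≠ y.1 ∧ 1 ≠ y.1 ∧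
      y.1 ∉ [1, 2, 3, 4, 5, 6, 7, 8, 9, 10, 11] := by
    intro y hy
    simp only [List.mem_cons, List.not_mem_nil, or_false]
    rcases mem_guessLoops hy with rfl | rfl | rfl | ⟨s, -, rfl⟩ <;> dsimp only <;> omega
  have hset : ∀ y ∈ guessLoops n K N, ∀ μ r, I μ → I (μ.setNat y.1 0 r) := by
    rintro y hy μ r ⟨h1, h2, A, h3, h4⟩
    obtain ⟨e1, e2, -⟩ := hne y hy
    exact ⟨by simp [e1, h1], h2, A, by simpa [e2] using h3, h4⟩
  have heval : ∀ y ∈ guessLoops n K N, ∀ μ, I μ → y.2.eval μ = bd y.1 := by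
    rintro y hy μ ⟨h1, -⟩
    rcases mem_guessLoops hy with rfl | rfl | rfl | ⟨s, -, rfl⟩
    · simp [hbd, NExpr.eval]
    · simp [hbd, h1]
    · simp [hbd, NExpr.eval, h1]
    · have a1 : 20 + s ≠ 12 := by omega
      have a2 : 20 + s ≠ 13 := by omega
      have a3 : 20 + s ≠ 14 := by omega
      simp [hbd, NExpr.eval, h1, a1, a2, a3]
  have h12 : (12, NExpr.const n) ∈ guessLoops n K N := by simp [guessLoops]
  have h13 : (13, var 0) ∈ guessLoops n K N := by simp [guessLoops]
  have h14 : (14, .add ((var 0).nsmul N) (.const 1)) ∈ guessLoops n K N := by simp [guessLoops]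
  have h20 : ∀ s < n * K, (20 + s, .add (var 0) (.const 1)) ∈ guessLoops n K N := by
    intro s hs; simp [guessLoops, hs]
  have hguess : ∀ μ, I μ → (∀ y ∈ guessLoops n K N, μ.nat y.1 0 < bd y.1) →
      ∃ (i₀ : Fin n) (j₀ : Fin m), μ.nat 12 0 = i₀ ∧ μ.nat 13 0 = j₀ := by
    intro μ _ hlt
    exact ⟨⟨μ.nat 12 0, by simpa [hbd] using hlt _ h12⟩,
      ⟨μ.nat 13 0, by simpa [hbd] using hlt _ h13⟩, rfl, rfl⟩
  -- The initial zeros encode the allocation that gives everything to agent `0`, of value at least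
  -- `0`; hence there is a valid output even if `m = 0` and no guess is tried.
  have hstart : I (start (algorithm n l p K Q N) m).mem :=
    ⟨by simp [start], by simp [start], fun _ => ⟨0, hn1⟩, by simp [start],
      fun i => by simpa [start] using (hv i).nonneg _⟩
  have hγ := gap_pos hε
  rcases (opt_nonneg hv).eq_or_lt with h0 | hpos
  · rw [← h0, mul_zero, max_self]
    refine (wp_nest _ (bd := bd) (I := I) hnodup hbdb hset heval ?_ hstart).mono ?_
    · rintro μ hμ hlt
      obtain ⟨i₀, j₀, hi, hj⟩ := hguess μ hμ hlt
      refine (wp_tryGuess hv hp hl1 hQ (by omega) hbn hbl hbs hγ.le hpar hμ.1 hi hj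
        hμ.2.2).mono ?_
      rintro μ' ⟨f, k1, k2, -⟩
      exact ⟨⟨by rw [f.nat 0 (by decide), hμ.1], hμ.2.1.trans k2, k1⟩,
        fun y hy => by rw [f.nat _ (hne y hy).2.2]⟩
    · rintro μ' ⟨-, h2, A, h3, h4⟩
      exact ⟨A, h3, fun i => h2.trans (h4 i)⟩
  · obtain ⟨i₁, j₁, r, hr, hτ, hτle, hτge⟩ := exists_target hv hn1 hpos hN
    set τ := v i₁ {j₁} * r / N with hτdef
    obtain ⟨O, hO, -⟩ := exists_opt_allocation hn1 v
    choose B hBO hBcard hB using fun i => exists_pins hτ (hv i) (bundle O i) hK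
    obtain ⟨c, hc1, hc2, hc3⟩ := exists_slots B hBcard
    refine (wp_nest_goal _ (bd := bd) (g := fun x => if x = 12 then i₁ else if x = 13 then j₁
      else if x = 14 then r else c (x - 20)) (I := I)
      (G := fun μ => (1 - gap ε) * τ ≤ μ.real 4 0) hnodup hbdb ?_ hset
      (fun _ _ _ _ h => h) heval ?_ hstart).mono ?_
    · intro y hy
      simp only [hbd]
      split_ifs
      · exact i₁.2
      · exact j₁.2
      · exact hr
      · exact hc1 _
    · rintro μ hμ hlt
      obtain ⟨i₀, j₀, hi, hj⟩ := hguess μ hμ hlt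
      refine (wp_tryGuess hv hp hl1 hQ (by omega) hbn hbl hbs hγ.le hpar hμ.1 hi hj
        hμ.2.2).mono ?_
      rintro μ' ⟨f, k1, k2, k3⟩
      refine ⟨⟨by rw [f.nat 0 (by decide), hμ.1], hμ.2.1.trans k2, k1⟩,
        fun y hy => by rw [f.nat _ (hne y hy).2.2], ?_⟩
      rintro (hG | hG)
      · exact hG.trans k2
      · have e12 : μ.nat 12 0 = i₁ := by simpa using hG _ h12
        have e13 : μ.nat 13 0 = j₁ := by simpa using hG _ h13
        have e14 : μ.nat 14 0 = r := by simpa using hG _ h14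
        have e20 : ∀ s < n * K, μ.nat (20 + s) 0 = c s := by
          intro s hs
          have a1 : 20 + s ≠ 12 := by omega
          have a2 : 20 + s ≠ 13 := by omega
          have a3 : 20 + s ≠ 14 := by omega
          simpa [a1, a2, a3] using hG _ (h20 s hs)
        obtain rfl : i₀ = i₁ := Fin.ext (hi.symm.trans e12)
        obtain rfl : j₀ = j₁ := Fin.ext (hj.symm.trans e13)
        refine k3 τ (by rw [hτdef, e14]) hτ O B (fun i => hτle.trans (hO i)) hBO hB ?_ ?_
        · intro s hs j hj
          rw [e20 s hs] at hj
          exact hc2 s hs j hj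
        · intro i j hj
          obtain ⟨s, hs, hsj⟩ := hc3 i j hj
          exact ⟨s, hs, by rw [e20 s hs, hsj]⟩
    · rintro μ' ⟨⟨-, h2, A, h3, h4⟩, h5⟩
      refine ⟨A, h3, fun i => le_trans (max_le h2 (le_trans ?_ h5)) (h4 i)⟩
      have e : 1 - 1 / Real.exp 1 - ε = 1 - gap ε - ε / 2 := by unfold gap; ring
      rw [e]
      -- For large `ε` the factor `1 - gap ε` is negative, and the upper bound `τ ≤ opt v` takes the
      -- place of the lower bound.
      rcases le_total 0 (1 - gap ε) with h | h
      · have h6 := mul_le_mul_of_nonneg_left hτge h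
        have h7 : (1 - gap ε) * (1 / (N : ℝ)) ≤ ε / 2 := by
          have h8 : 0 ≤ 1 / (N : ℝ) := by positivity
          nlinarith
        have h9 := mul_le_mul_of_nonneg_right h7 hpos.le
        linarith
      · have h6 := mul_le_mul_of_nonpos_left hτle h
        have h7 : 0 ≤ ε / 2 * opt v := by positivity
        linarith

end Main

end MaxMin

/-- Every loop has at most `κ * (m + 1)` iterations, which gives the polynomial time bound. The run
ends in a point mass, so the required probability is exceeded trivially. -/
theorem mainTheorem4 (n : ℕ) (hn : 1 ≤ n) (ε : ℝ) (hε : 0 < ε) :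
    ∃ (P : MaxMin.Prog) (C d : ℕ), ∀ (m : ℕ) (v : Fin n → Finset (Fin m) → ℝ),
      (∀ i, MaxMin.IsValuation (v i)) →
        (∀ c ∈ (MaxMin.run v (C * (m + 1) ^ d) (MaxMin.start P m)).support,
          ∃ A : Fin m → Fin n, MaxMin.Outputs c A) ∧
        ENNReal.ofReal (1 - 1 / ((m : ℝ) + 1)) ≤
          (MaxMin.run v (C * (m + 1) ^ d) (MaxMin.start P m)).toOuterMeasure
            {c | ∃ A : Fin m → Fin n, MaxMin.Outputs c A ∧
              (1 - 1 / Real.exp 1 - ε) * MaxMin.opt v ≤ MaxMin.minValue v A} := by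
  obtain ⟨p, l, K, Q, N, hp, hl, hK, hQ, hN, hNε, hpar⟩ := MaxMin.exists_parameters n hε
  obtain ⟨C, d, hC⟩ := MaxMin.exists_cost_le (MaxMin.algorithm n l p K Q N)
  set κ := n + l + N + MaxMin.sweepFactor n l p Q with hκ
  refine ⟨MaxMin.algorithm n l p K Q N, C * (κ + 1) ^ d, d, fun m v hv => ?_⟩
  have hT : MaxMin.cost (κ * (m + 1)) (MaxMin.algorithm n l p K Q N)
      ≤ C * (κ + 1) ^ d * (m + 1) ^ d := by
    refine (hC _).trans ?_
    rw [mul_assoc, ← mul_pow]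
    exact Nat.mul_le_mul_left C (Nat.pow_le_pow_left (by nlinarith) d)
  obtain ⟨μ, hrun, A, hA, hval⟩ :=
    (MaxMin.wp_algorithm hv hn hε hp hl hK hQ hN hNε hpar le_rfl).run_eq hT
  have hrun' : MaxMin.run v (C * (κ + 1) ^ d * (m + 1) ^ d)
      (MaxMin.start (MaxMin.algorithm n l p K Q N) m) = PMF.pure ⟨[], μ⟩ := hrun
  rw [hrun']
  have hout : MaxMin.Outputs (⟨[], μ⟩ : MaxMin.Config) A := ⟨rfl, hA⟩
  refine ⟨fun c hc => ?_, ?_⟩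
  · rw [PMF.support_pure, Set.mem_singleton_iff] at hc
    exact ⟨A, hc ▸ hout⟩
  · have : Nonempty (Fin n) := ⟨⟨0, hn⟩⟩
    rw [PMF.toOuterMeasure_pure_apply, if_pos]
    · refine ENNReal.ofReal_le_one.2 ?_
      have : (0 : ℝ) ≤ 1 / ((m : ℝ) + 1) := by positivity
      linarith
    · exact ⟨A, hout, le_ciInf fun i => (le_max_right _ _).trans (hval i)⟩
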